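/- For $n\ge 0$ let $\mathcal F_n$ be the $\sigma$-algebra on $\mathbb R$ generated by the dyadic intervals $[k2^{-n},(k+1)2^{-n})$, $k\in\mathbb Z$, let $\mathbb P$ be a Borel probability measure on $\mathbb R$, let $\mathbb E_n$ be the conditional expectation with respect to $\mathcal F_n$, and put $A_j=[j,j+1)$ for $j\in\mathbb Z$. A dyadic martingale is a sequence $f=(f_n)_{n\ge0}$ of real functions with $f_0=0$ such that, for every $j$, $(f_n\mathbf 1_{A_j})_{n\ge0}$ is a martingale with respect to $(\mathcal F_n)$ and $\mathbb P$ (so $f_n$ is $\mathcal F_n$-measurable and integrable on each $A_j$; integrability on all of $\mathbb R$ is not required). Put $d_nf=f_n-f_{n-1}$, $d_0f=0$, and $$s(f)=\Big(\sum_{n}\mathbb E_{n-1}|d_nf|^2\Big)^{1/2},\qquad \|f\|_{H^s_{p,q}}=\Big(\sum_{j\in\mathbb Z}\Big(\int_{A_j}s(f)^p\,d\mathbb P\Big)^{q/p}\Big)^{1/q},$$ and let $H^s_{p,q}$ be the normed space of dyadic martingales $f$ with $\|f\|_{H^s_{p,q}}<\infty$, almost surely equal martingales being identified. Let $1<q\le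 p\le2$ or $2\le p\le q<\infty$, and let $\frac1p+\frac1{p'}=\frac1q+\frac1{q'}=1$. Then the dual space of $H^s_{p,q}$ identifies with $H^s_{p',q'}$: for $f\in H^s_{p,q}$ and $g\in H^s_{p',q'}$ one has $\mathbb E\sum_n|d_nf\,d_ng|<\infty$, and the map $g\mapsto\kappa_g$, $$\kappa_g(f)=\mathbb E\Big(\sum_{n=0}^\infty d_nf\,d_ng\Big),$$ is a linear bijection of $H^s_{p',q'}$ onto $(H^s_{p,q})^*$, with $$\|\kappa_g\|\le\|g\|_{H^s_{p',q'}}\le C\,\|\kappa_g\|,$$ where $C>0$ depends only on $p$ and $q$ (not on $\mathbb P$). -/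

import Mathlib

open MeasureTheory ProbabilityTheory Filter Set
open scoped ENNReal

noncomputable section

namespace DyadicHardy

/-- The dyadic interval `[k / 2 ^ n, (k + 1) / 2 ^ n)`. -/
def dyadicInterval (n : ℕ) (k : ℤ) : Set ℝ :=
  Ico ((k : ℝ) / 2 ^ n) (((k : ℝ) + 1) / 2 ^ n)

/-- The unit interval `A_j = [j, j + 1)`. -/
def cell (j : ℤ) : Set ℝ := Ico (j : ℝ) ((j : ℝ) + 1)

theorem measurableSet_cell (j : ℤ) : MeasurableSet (cell j) := measurableSet_Ico

theorem dyadicInterval_eq_union (n : ℕ) (k : ℤ) :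
    dyadicInterval n k =
      dyadicInterval (n + 1) (2 * k) ∪ dyadicInterval (n + 1) (2 * k + 1) := by
  have h2 : (0 : ℝ) < 2 ^ n := by positivity
  have e1 : (((2 * k : ℤ) : ℝ)) / 2 ^ (n + 1) = (k : ℝ) / 2 ^ n := by
    push_cast; field_simp; ring
  have e2 : ((((2 * k + 1 : ℤ) : ℝ)) + 1) / 2 ^ (n + 1) = ((k : ℝ) + 1) / 2 ^ n := by
    push_cast; field_simp; ring
  have e3 : (((2 * k : ℤ) : ℝ) + 1) / 2 ^ (n + 1) = (((2 * k + 1 : ℤ) : ℝ)) / 2 ^ (n + 1) := by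
    push_cast; ring
  unfold dyadicInterval
  rw [e3, Ico_union_Ico_eq_Ico, e1, e2]
  · gcongr; simp
  · gcongr; simp

/-- The dyadic filtration: `ℱ n` is the σ-algebra generated by the dyadic intervals of
length `2 ^ (-n)`. -/
def dyadicFiltration : Filtration ℕ (inferInstance : MeasurableSpace ℝ) where
  seq n := MeasurableSpace.generateFrom (range (dyadicInterval n))
  mono' := by
    refine monotone_nat_of_le_succ fun n => MeasurableSpace.generateFrom_le ?_
    rintro _ ⟨k, rfl⟩
    rw [dyadicInterval_eq_union]
    exact MeasurableSet.union
      (MeasurableSpace.measurableSet_generateFrom (mem_range_self (2 * k)))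
      (MeasurableSpace.measurableSet_generateFrom (mem_range_self (2 * k + 1)))
  le' n := by
    refine MeasurableSpace.generateFrom_le ?_
    rintro _ ⟨k, rfl⟩
    exact measurableSet_Ico

/-- Dyadic martingales `f = (f_n)` with `f_0 = 0`. Since each `A_j` lies in every `ℱ n`, the
conditional expectations act on each `A_j` separately; the martingale property is required on
each `A_j`. (An `ℱ n`-measurable function is constant on dyadic intervals of length `2 ^ (-n)`,
so it is integrable on each `A_j`, whether or not it is integrable on all of `ℝ`.) -/
def IsDyadicMartingale (P : Measure ℝ) (f : ℕ → ℝ → ℝ) : Prop :=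
  f 0 = 0 ∧ ∀ j : ℤ, Martingale (fun n => (cell j).indicator (f n)) dyadicFiltration P

/-- The martingale difference `d_n f = f_n - f_{n-1}`; truncated subtraction of indices gives
the convention `d_0 f = 0`. -/
def mdiff (f : ℕ → ℝ → ℝ) (n : ℕ) : ℝ → ℝ := f n - f (n - 1)

/-- The conditional quadratic variation `s(f) = (∑ₙ E_{n-1} |d_n f|²) ^ (1/2)`; the term `n = 0`
vanishes as `d_0 f = 0`. The conditional expectation is that of functions with values in
`[0, ∞]`, so no integrability is presupposed. -/
def condSq (P : Measure ℝ) (f : ℕ → ℝ → ℝ) (x : ℝ) : ℝ≥0∞ :=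
  (∑' n : ℕ, condLExp (dyadicFiltration (n - 1)) P (fun y => ‖mdiff f n y‖ₑ ^ 2) x) ^ (1 / 2 : ℝ)

/-- The norm of the amalgam space `L_{p,q}`: the `ℓ_q(ℤ)` norm of the sequence
`j ↦ ‖u 1_{A_j}‖_{L_p(P)}`. -/
def amalgamNorm (P : Measure ℝ) (p q : ℝ≥0∞) (u : ℝ → ℝ≥0∞) : ℝ≥0∞ :=
  eLpNorm (fun j : ℤ => eLpNorm u p (P.restrict (cell j))) q Measure.count

theorem mdiff_add (f g : ℕ → ℝ → ℝ) (n : ℕ) : mdiff (f + g) n = mdiff f n + mdiff g n := by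
  ext x; simp [mdiff]; ring

theorem mdiff_smul (c : ℝ) (f : ℕ → ℝ → ℝ) (n : ℕ) : mdiff (c • f) n = c • mdiff f n := by
  ext x; simp [mdiff]; ring

theorem measurable_of_indicator_cell {u : ℝ → ℝ}
    (hc : ∀ j : ℤ, Measurable ((cell j).indicator u)) : Measurable u := by
  intro s hs
  have : u ⁻¹' s = ⋃ j : ℤ, ((cell j).indicator u ⁻¹' s ∩ cell j) := by
    ext x
    simp only [mem_preimage, mem_iUnion, mem_inter_iff]
    constructor
    · intro hx
      have hxc : x ∈ cell ⌊x⌋ := ⟨Int.floor_le x, Int.lt_floor_add_one x⟩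
      exact ⟨⌊x⌋, by rwa [indicator_of_mem hxc], hxc⟩
    · rintro ⟨j, hj, hxc⟩
      rwa [indicator_of_mem hxc] at hj
  rw [this]
  exact MeasurableSet.iUnion fun j => (hc j hs).inter (measurableSet_cell j)

theorem IsDyadicMartingale.measurable {P : Measure ℝ} {f : ℕ → ℝ → ℝ}
    (hf : IsDyadicMartingale P f) (n : ℕ) : Measurable (f n) := by
  have hc : ∀ j : ℤ, Measurable ((cell j).indicator (f n)) := fun j =>
    (((hf.2 j).1 n).mono (dyadicFiltration.le n)).measurable
  exact measurable_of_indicator_cell hc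

theorem IsDyadicMartingale.mdiff_measurable {P : Measure ℝ} {f : ℕ → ℝ → ℝ}
    (hf : IsDyadicMartingale P f) (n : ℕ) : Measurable (mdiff f n) :=
  (hf.measurable n).sub (hf.measurable (n - 1))

theorem IsDyadicMartingale.zero (P : Measure ℝ) :
    IsDyadicMartingale P 0 :=
  ⟨rfl, fun j => by
    have : (fun n => (cell j).indicator ((0 : ℕ → ℝ → ℝ) n)) = 0 := by
      ext n x; simp
    rw [this]
    exact martingale_zero ℝ dyadicFiltration P⟩

theorem IsDyadicMartingale.add {P : Measure ℝ} {f g : ℕ → ℝ → ℝ}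
    (hf : IsDyadicMartingale P f) (hg : IsDyadicMartingale P g) :
    IsDyadicMartingale P (f + g) :=
  ⟨by simp [hf.1, hg.1], fun j => by
    have : (fun n => (cell j).indicator ((f + g) n)) =
        (fun n => (cell j).indicator (f n)) + fun n => (cell j).indicator (g n) := by
      ext n x
      simp only [Pi.add_apply]
      rw [indicator_add']
      rfl
    rw [this]
    exact (hf.2 j).add (hg.2 j)⟩

theorem IsDyadicMartingale.smul {P : Measure ℝ} {f : ℕ → ℝ → ℝ}
    (c : ℝ) (hf : IsDyadicMartingale P f) : IsDyadicMartingale P (c • f) :=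
  ⟨by simp [hf.1], fun j => by
    have : (fun n => (cell j).indicator ((c • f) n)) =
        c • fun n => (cell j).indicator (f n) := by
      ext n x; simp [indicator]
    rw [this]
    exact (hf.2 j).smul c⟩

theorem measurable_condSq (P : Measure ℝ) (f : ℕ → ℝ → ℝ) : Measurable (condSq P f) := by
  unfold condSq
  fun_prop

theorem sq_add_le_weighted (a b : ℝ) (u v : ℝ) (hu : 0 < u) (hv : 0 < v) :
    ‖a + b‖ₑ ^ 2 ≤ ENNReal.ofReal (1 + v / u) * ‖a‖ₑ ^ 2
      + ENNReal.ofReal (1 + u / v) * ‖b‖ₑ ^ 2 := by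
  have key : |a + b| ^ 2 ≤ (1 + v / u) * |a| ^ 2 + (1 + u / v) * |b| ^ 2 := by
    simp only [sq_abs]
    have : (1 + v / u) * a ^ 2 + (1 + u / v) * b ^ 2 - (a + b) ^ 2
        = (v * a - u * b) ^ 2 / (u * v) := by
      field_simp; ring
    have h2 : 0 ≤ (v * a - u * b) ^ 2 / (u * v) := by positivity
    linarith
  simp only [← ofReal_norm, Real.norm_eq_abs]
  rw [← ENNReal.ofReal_pow (abs_nonneg _), ← ENNReal.ofReal_pow (abs_nonneg _),
    ← ENNReal.ofReal_pow (abs_nonneg _), ← ENNReal.ofReal_mul (by positivity),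
    ← ENNReal.ofReal_mul (by positivity), ← ENNReal.ofReal_add (by positivity) (by positivity)]
  exact ENNReal.ofReal_le_ofReal key

theorem condSq_sq (P : Measure ℝ) (f : ℕ → ℝ → ℝ) (x : ℝ) :
    condSq P f x ^ 2 =
      ∑' n : ℕ, condLExp (dyadicFiltration (n - 1)) P (fun y => ‖mdiff f n y‖ₑ ^ 2) x := by
  rw [condSq, ← ENNReal.rpow_natCast, ← ENNReal.rpow_mul]
  norm_num

theorem condSq_add_sq_le {P : Measure ℝ} {f g : ℕ → ℝ → ℝ}
    (hf : IsDyadicMartingale P f) (hg : IsDyadicMartingale P g)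
    (u v : ℝ) (hu : 0 < u) (hv : 0 < v) :
    ∀ᵐ x ∂P, condSq P (f + g) x ^ 2 ≤ ENNReal.ofReal (1 + v / u) * condSq P f x ^ 2
      + ENNReal.ofReal (1 + u / v) * condSq P g x ^ 2 := by
  have H : ∀ n : ℕ, ∀ᵐ x ∂P,
      condLExp (dyadicFiltration (n - 1)) P (fun y => ‖mdiff (f + g) n y‖ₑ ^ 2) x ≤
      ENNReal.ofReal (1 + v / u) *
          condLExp (dyadicFiltration (n - 1)) P (fun y => ‖mdiff f n y‖ₑ ^ 2) x +
        ENNReal.ofReal (1 + u / v) *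
          condLExp (dyadicFiltration (n - 1)) P (fun y => ‖mdiff g n y‖ₑ ^ 2) x := by
    intro n
    have mf := hf.mdiff_measurable n
    have mg := hg.mdiff_measurable n
    have m1 : Measurable (fun y => ‖mdiff f n y‖ₑ ^ 2) := by fun_prop
    have m2 : Measurable (fun y => ‖mdiff g n y‖ₑ ^ 2) := by fun_prop
    have h1 := condLExp_mono (P := P) (mΩ := dyadicFiltration (n - 1))
      (X := fun y => ‖mdiff (f + g) n y‖ₑ ^ 2)
      (Y := (ENNReal.ofReal (1 + v / u)) • (fun y => ‖mdiff f n y‖ₑ ^ 2)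
        + (ENNReal.ofReal (1 + u / v)) • (fun y => ‖mdiff g n y‖ₑ ^ 2))
      (ae_of_all _ fun y => by
        simpa [mdiff_add] using sq_add_le_weighted (mdiff f n y) (mdiff g n y) u v hu hv)
    have h2 := condLExp_add_left (P := P) (mΩ := dyadicFiltration (n - 1))
      (X := (ENNReal.ofReal (1 + v / u)) • (fun y => ‖mdiff f n y‖ₑ ^ 2))
      ((ENNReal.ofReal (1 + u / v)) • (fun y => ‖mdiff g n y‖ₑ ^ 2))
      (m1.const_smul _).aemeasurable
    have h3 := condLExp_smul (P := P) (mΩ := dyadicFiltration (n - 1)) _ m1.aemeasurable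
      (ENNReal.ofReal (1 + v / u))
    have h4 := condLExp_smul (P := P) (mΩ := dyadicFiltration (n - 1)) _ m2.aemeasurable
      (ENNReal.ofReal (1 + u / v))
    filter_upwards [h1, h2, h3, h4] with x h1 h2 h3 h4
    rw [h2, Pi.add_apply, h3, h4] at h1
    simpa using h1
  filter_upwards [ae_all_iff.2 H] with x hx
  rw [condSq_sq, condSq_sq, condSq_sq, ← ENNReal.tsum_mul_left, ← ENNReal.tsum_mul_left,
    ← ENNReal.tsum_add]
  exact ENNReal.tsum_le_tsum hx

theorem le_add_of_weighted {a x y : ℝ≥0∞}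
    (h : ∀ u v : ℚ, 0 < u → 0 < v → a ^ 2 ≤ ENNReal.ofReal (1 + v / u) * x ^ 2
      + ENNReal.ofReal (1 + u / v) * y ^ 2) : a ≤ x + y := by
  rcases eq_or_ne x ∞ with rfl | hx
  · simp
  rcases eq_or_ne y ∞ with rfl | hy
  · simp
  lift x to NNReal using hx
  lift y to NNReal using hy
  have hfin : a ≠ ∞ := by
    rintro rfl
    have := h 1 1 one_pos one_pos
    have h2 : ENNReal.ofReal (1 + ((1 : ℚ) : ℝ) / ((1 : ℚ) : ℝ)) * (x : ℝ≥0∞) ^ 2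
      + ENNReal.ofReal (1 + ((1 : ℚ) : ℝ) / ((1 : ℚ) : ℝ)) * (y : ℝ≥0∞) ^ 2 ≠ ∞ := by
      finiteness
    apply h2
    simpa using this
  lift a to NNReal using hfin
  have h' : ∀ u v : ℚ, 0 < u → 0 < v → (a : ℝ) ^ 2 ≤ (1 + v / u) * (x : ℝ) ^ 2
      + (1 + u / v) * (y : ℝ) ^ 2 := by
    intro u v hu hv
    have hu' : (0 : ℝ) < u := by exact_mod_cast hu
    have hv' : (0 : ℝ) < v := by exact_mod_cast hv
    have h0 := ENNReal.toReal_mono (by finiteness) (h u v hu hv)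
    rw [ENNReal.toReal_add (by finiteness) (by finiteness), ENNReal.toReal_mul,
      ENNReal.toReal_mul, ENNReal.toReal_ofReal (by positivity),
      ENNReal.toReal_ofReal (by positivity)] at h0
    simpa using h0
  have main : (a : ℝ) ≤ x + y := by
    refine le_of_forall_pos_le_add fun ε hε => ?_
    obtain ⟨u, hu1, hu2⟩ := exists_rat_btwn (show (x : ℝ) < x + ε / 2 by linarith)
    obtain ⟨v, hv1, hv2⟩ := exists_rat_btwn (show (y : ℝ) < y + ε / 2 by linarith)
    have hu : (0 : ℝ) < u := lt_of_le_of_lt x.2 hu1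
    have hv : (0 : ℝ) < v := lt_of_le_of_lt y.2 hv1
    have h1 := h' u v (by exact_mod_cast hu) (by exact_mod_cast hv)
    have hx2 : (x : ℝ) ^ 2 ≤ (u : ℝ) ^ 2 := pow_le_pow_left₀ x.2 hu1.le 2
    have hy2 : (y : ℝ) ^ 2 ≤ (v : ℝ) ^ 2 := pow_le_pow_left₀ y.2 hv1.le 2
    have h2 : (a : ℝ) ^ 2 ≤ (u + v : ℝ) ^ 2 := by
      calc (a : ℝ) ^ 2 ≤ (1 + v / u) * (x : ℝ) ^ 2 + (1 + u / v) * (y : ℝ) ^ 2 := h1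
        _ ≤ (1 + v / u) * (u : ℝ) ^ 2 + (1 + u / v) * (v : ℝ) ^ 2 := by gcongr
        _ = (u + v : ℝ) ^ 2 := by field_simp; ring
    have h3 := abs_le_of_sq_le_sq' h2 (by positivity)
    linarith [h3.2]
  exact_mod_cast main

theorem condSq_add_le {P : Measure ℝ} {f g : ℕ → ℝ → ℝ}
    (hf : IsDyadicMartingale P f) (hg : IsDyadicMartingale P g) :
    ∀ᵐ x ∂P, condSq P (f + g) x ≤ condSq P f x + condSq P g x := by
  have H : ∀ᵐ x ∂P, ∀ u v : ℚ, 0 < u → 0 < v →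
      condSq P (f + g) x ^ 2 ≤ ENNReal.ofReal (1 + v / u) * condSq P f x ^ 2
        + ENNReal.ofReal (1 + u / v) * condSq P g x ^ 2 := by
    simp only [ae_all_iff]
    intro u v hu hv
    exact condSq_add_sq_le hf hg u v (by exact_mod_cast hu) (by exact_mod_cast hv)
  filter_upwards [H] with x hx using le_add_of_weighted hx

theorem condSq_smul {P : Measure ℝ} {f : ℕ → ℝ → ℝ} (c : ℝ) :
    ∀ᵐ x ∂P, condSq P (c • f) x = ‖c‖ₑ * condSq P f x := by
  have H : ∀ n : ℕ, ∀ᵐ x ∂P,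
      condLExp (dyadicFiltration (n - 1)) P (fun y => ‖mdiff (c • f) n y‖ₑ ^ 2) x =
      ‖c‖ₑ ^ 2 * condLExp (dyadicFiltration (n - 1)) P (fun y => ‖mdiff f n y‖ₑ ^ 2) x := by
    intro n
    have e : (fun y => ‖mdiff (c • f) n y‖ₑ ^ 2) = (‖c‖ₑ ^ 2) • fun y => ‖mdiff f n y‖ₑ ^ 2 := by
      ext y
      simp [mdiff_smul, enorm_mul, mul_pow]
    rw [e]
    filter_upwards [condLExp_smul' (P := P) (mΩ := dyadicFiltration (n - 1))
      (fun y => ‖mdiff f n y‖ₑ ^ 2) (c := ‖c‖ₑ ^ 2) (by finiteness)] with x hx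
    simpa using hx
  filter_upwards [ae_all_iff.2 H] with x hx
  rw [condSq, condSq, tsum_congr hx, ENNReal.tsum_mul_left,
    ENNReal.mul_rpow_of_nonneg _ _ (by norm_num), ← ENNReal.rpow_natCast, ← ENNReal.rpow_mul]
  norm_num

theorem amalgamNorm_mono {P : Measure ℝ} {p q : ℝ≥0∞} {u v : ℝ → ℝ≥0∞}
    (h : ∀ᵐ x ∂P, u x ≤ v x) : amalgamNorm P p q u ≤ amalgamNorm P p q v := by
  unfold amalgamNorm
  refine eLpNorm_mono_enorm fun j => ?_
  simp only [enorm_eq_self]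
  exact eLpNorm_mono_enorm_ae (ae_restrict_of_ae (by simpa using h))

theorem amalgamNorm_add_le {P : Measure ℝ} {p q : ℝ≥0∞} (hp : 1 ≤ p) (hq : 1 ≤ q)
    {u v : ℝ → ℝ≥0∞} (hu : Measurable u) (hv : Measurable v) :
    amalgamNorm P p q (u + v) ≤ amalgamNorm P p q u + amalgamNorm P p q v := by
  unfold amalgamNorm
  refine le_trans (eLpNorm_mono_enorm (g := (fun j : ℤ => eLpNorm u p (P.restrict (cell j))) +
    fun j : ℤ => eLpNorm v p (P.restrict (cell j))) fun j => ?_) (eLpNorm_add_le ?_ ?_ hq)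
  · simp only [enorm_eq_self, Pi.add_apply]
    exact eLpNorm_add_le hu.aestronglyMeasurable hv.aestronglyMeasurable hp
  · exact (measurable_of_countable _).aestronglyMeasurable
  · exact (measurable_of_countable _).aestronglyMeasurable

theorem eLpNorm_const_mul_le {α : Type*} [MeasurableSpace α] (μ : Measure α) (p : ℝ≥0∞) (c : ℝ)
    (u : α → ℝ≥0∞) : eLpNorm (fun x => ‖c‖ₑ * u x) p μ ≤ ‖c‖ₑ * eLpNorm u p μ := by
  have h := eLpNorm_le_nnreal_smul_eLpNorm_of_ae_le_mul' (μ := μ)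
    (f := fun x => ‖c‖ₑ * u x) (g := u) (c := ‖c‖₊) (ae_of_all _ fun x => by simp; rfl) p
  exact h

theorem amalgamNorm_const_mul_le (P : Measure ℝ) (p q : ℝ≥0∞) (c : ℝ) (u : ℝ → ℝ≥0∞) :
    amalgamNorm P p q (fun x => ‖c‖ₑ * u x) ≤ ‖c‖ₑ * amalgamNorm P p q u := by
  unfold amalgamNorm
  refine le_trans (eLpNorm_mono_enorm fun j => ?_) (eLpNorm_const_mul_le _ q c _)
  simp only [enorm_eq_self]
  exact eLpNorm_const_mul_le _ p c u

theorem amalgamNorm_condSq_add_le {P : Measure ℝ} {p q : ℝ≥0∞} (hp : 1 ≤ p) (hq : 1 ≤ q)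
    {f g : ℕ → ℝ → ℝ} (hf : IsDyadicMartingale P f) (hg : IsDyadicMartingale P g) :
    amalgamNorm P p q (condSq P (f + g)) ≤
      amalgamNorm P p q (condSq P f) + amalgamNorm P p q (condSq P g) :=
  (amalgamNorm_mono (condSq_add_le hf hg)).trans
    (amalgamNorm_add_le hp hq (measurable_condSq P f) (measurable_condSq P g))

theorem amalgamNorm_condSq_smul_le {P : Measure ℝ} {p q : ℝ≥0∞} (c : ℝ) (f : ℕ → ℝ → ℝ) :
    amalgamNorm P p q (condSq P (c • f)) ≤ ‖c‖ₑ * amalgamNorm P p q (condSq P f) :=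
  (amalgamNorm_mono ((condSq_smul c).mono fun _ h => h.le)).trans
    (amalgamNorm_const_mul_le P p q c _)

theorem amalgamNorm_condSq_zero (P : Measure ℝ) (p q : ℝ≥0∞) :
    amalgamNorm P p q (condSq P 0) = 0 := by
  have := amalgamNorm_condSq_smul_le (P := P) (p := p) (q := q) 0 0
  simpa using this

section Space

variable (P : Measure ℝ) (p q : ℝ≥0∞) [Fact (1 ≤ p)] [Fact (1 ≤ q)]

/-- The vector space of dyadic martingales `f` with `s(f) ∈ L_{p,q}`. -/
def hsSubmodule : Submodule ℝ (ℕ → ℝ → ℝ) where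
  carrier := {f | IsDyadicMartingale P f ∧ amalgamNorm P p q (condSq P f) < ∞}
  zero_mem' := ⟨IsDyadicMartingale.zero P, by rw [amalgamNorm_condSq_zero]; simp⟩
  add_mem' hf hg := ⟨hf.1.add hg.1,
    (amalgamNorm_condSq_add_le Fact.out Fact.out hf.1 hg.1).trans_lt
      (ENNReal.add_lt_top.2 ⟨hf.2, hg.2⟩)⟩
  smul_mem' c _ hf := ⟨hf.1.smul c,
    (amalgamNorm_condSq_smul_le c _).trans_lt (ENNReal.mul_lt_top (by finiteness) hf.2)⟩

/-- The martingales of `H^s_{p,q}`, before identification of almost surely equal ones. A type of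
its own, so that it carries only the topology of the `H^s_{p,q}` norm. -/
def HsMartingale : Type := hsSubmodule P p q

instance : AddCommGroup (HsMartingale P p q) :=
  inferInstanceAs (AddCommGroup (hsSubmodule P p q))

instance : Module ℝ (HsMartingale P p q) :=
  inferInstanceAs (Module ℝ (hsSubmodule P p q))

variable {P p q}

/-- The martingale `(f_n)` underlying `f`. -/
def HsMartingale.seq (f : HsMartingale P p q) : ℕ → ℝ → ℝ := Subtype.val f

theorem HsMartingale.seq_mem (f : HsMartingale P p q) : f.seq ∈ hsSubmodule P p q :=
  Subtype.property f

/-- `‖f‖_{H^s_{p,q}} = ‖s(f)‖_{L_{p,q}}`. -/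
instance : Norm (HsMartingale P p q) :=
  ⟨fun f => (amalgamNorm P p q (condSq P f.seq)).toReal⟩

theorem HsMartingale.norm_def (f : HsMartingale P p q) :
    ‖f‖ = (amalgamNorm P p q (condSq P f.seq)).toReal := rfl

theorem HsMartingale.norm_smul_le' (c : ℝ) (f : HsMartingale P p q) : ‖c • f‖ ≤ ‖c‖ * ‖f‖ := by
  have h := ENNReal.toReal_mono (ENNReal.mul_ne_top (by finiteness) f.seq_mem.2.ne)
    (amalgamNorm_condSq_smul_le (P := P) (p := p) (q := q) c f.seq)
  rw [ENNReal.toReal_mul, toReal_enorm] at h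
  exact h

theorem HsMartingale.core : SeminormedSpace.Core ℝ (HsMartingale P p q) where
  norm_nonneg _ := ENNReal.toReal_nonneg
  norm_smul c f := by
    refine le_antisymm (HsMartingale.norm_smul_le' c f) ?_
    rcases eq_or_ne c 0 with rfl | hc
    · rw [norm_zero, zero_mul]; exact ENNReal.toReal_nonneg
    have h := HsMartingale.norm_smul_le' c⁻¹ (c • f)
    rw [smul_smul, inv_mul_cancel₀ hc, one_smul, norm_inv] at h
    have hc' : 0 < ‖c‖ := norm_pos_iff.2 hc
    rwa [inv_mul_eq_div, le_div_iff₀ hc', mul_comm] at h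
  norm_triangle f g := by
    have h := ENNReal.toReal_mono (ENNReal.add_ne_top.2 ⟨f.seq_mem.2.ne, g.seq_mem.2.ne⟩)
      (amalgamNorm_condSq_add_le (p := p) (q := q) Fact.out Fact.out f.seq_mem.1 g.seq_mem.1)
    rw [ENNReal.toReal_add f.seq_mem.2.ne g.seq_mem.2.ne] at h
    exact h

instance : SeminormedAddCommGroup (HsMartingale P p q) :=
  SeminormedAddCommGroup.ofCore HsMartingale.core

instance : NormedSpace ℝ (HsMartingale P p q) where
  norm_smul_le := HsMartingale.norm_smul_le'

variable (P p q)

/-- The normed space `H^s_{p,q}`: martingales at distance zero (that is, almost surely equal)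
are identified. -/
abbrev Hs : Type := SeparationQuotient (HsMartingale P p q)

variable {P p q}

/-- The element of `H^s_{p,q}` given by a martingale. -/
abbrev HsMartingale.toHs (f : HsMartingale P p q) : Hs P p q := SeparationQuotient.mk f

end Space

end DyadicHardy

end

open DyadicHardy

/-! Boundedness of the pairing. On a dyadic interval of generation `n - 1` the conditional second
moments of d_n f and d_n g are constants. Cauchy–Schwarz on each such interval, and then in n, gives
E ∑ |d_n f d_n g| ≤ E s(f) s(g). Hölder's inequality on each cell and over the cells then yields
‖κ_g‖ ≤ ‖g‖ (`lintegral_tsum_mdiff_mul_le`).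

Lower bound. Put S_n = ∑_{k ≤ n} E_{k-1}|d_k g|², which is ℱ_{n-1}-measurable. Fix N and a finite
set F of cells, let E_j be the integral of S_N^{p'/2} over A_j, and let T = ∑_{j ∈ F} E_j^{q'/p'}.
The test martingale f is the transform of g by the predictable weights E_j^{q'/p' - 1} S_n^{p'/2 -
1} for n ≤ N, j ∈ F. For θ > 0 the sum ∑ (S_n - S_{n-1}) S_n^{θ-1} is comparable with S_N^θ
(`partial_sum_rpow_bounds`). With θ = p'/2 this bounds the pairing of f and g below by a multiple of
T. With θ = p' - 1 it bounds s(f), and hence ‖f‖ by a multiple of T^{1/q}. Dividing bounds T^{1/q'}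
(`IsDyadicMartingale.sum_energy_le`), and monotone convergence in N and F bounds ‖g‖
(`IsDyadicMartingale.amalgamNorm_le`). This needs g to act boundedly on finite martingales only; g
need not be known to lie in the space.

Surjectivity. A functional κ, evaluated at the martingales generated by indicators of dyadic
intervals, is an additive function of intervals that vanishes on null ones. Its densities with
respect to P form a martingale g which represents κ on finite martingales (`functional_eq_sum`). The
lower bound places g in H^s_{p',q'}, and density of the finite martingales
(`IsDyadicMartingale.tendsto_truncation`) gives κ = κ_g everywhere. -/

noncomputable section

namespace DyadicHardy

/-! ### Dyadic intervals as the fibres of `dyadicIndex` -/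

/-- The index `k` of the dyadic interval of generation `n` that contains `x`. -/
def dyadicIndex (n : ℕ) (x : ℝ) : ℤ := ⌊x * 2 ^ n⌋

theorem dyadicIndex_eq_iff {n : ℕ} {k : ℤ} {x : ℝ} :
    dyadicIndex n x = k ↔ x ∈ dyadicInterval n k := by
  have h2 : (0 : ℝ) < 2 ^ n := by positivity
  rw [dyadicIndex, Int.floor_eq_iff, dyadicInterval, mem_Ico, div_le_iff₀ h2, lt_div_iff₀ h2]

theorem mem_dyadicInterval_dyadicIndex (n : ℕ) (x : ℝ) :
    x ∈ dyadicInterval n (dyadicIndex n x) := dyadicIndex_eq_iff.1 rfl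

theorem preimage_dyadicIndex_singleton (n : ℕ) (k : ℤ) :
    dyadicIndex n ⁻¹' {k} = dyadicInterval n k := by
  ext x; exact dyadicIndex_eq_iff

theorem dyadicInterval_zero (j : ℤ) : dyadicInterval 0 j = cell j := by
  simp [dyadicInterval, cell]

theorem pairwise_disjoint_dyadicInterval (n : ℕ) :
    Pairwise (Function.onFun Disjoint (dyadicInterval n)) := fun _ _ hkl =>
  Set.disjoint_left.2 fun _ hk hl =>
    hkl ((dyadicIndex_eq_iff.2 hk).symm.trans (dyadicIndex_eq_iff.2 hl))

theorem iUnion_dyadicInterval (n : ℕ) : ⋃ k, dyadicInterval n k = univ :=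
  eq_univ_of_forall fun x => mem_iUnion.2 ⟨_, mem_dyadicInterval_dyadicIndex n x⟩

theorem measurableSet_dyadicInterval (n : ℕ) (k : ℤ) :
    MeasurableSet[dyadicFiltration n] (dyadicInterval n k) :=
  MeasurableSpace.measurableSet_generateFrom (mem_range_self k)

theorem measurableSet_dyadicInterval' (n : ℕ) (k : ℤ) : MeasurableSet (dyadicInterval n k) :=
  measurableSet_Ico

/-- Since ℤ is countable and discrete, measurability at generation `n` means factoring through
`dyadicIndex n`. Conditional statements thereby reduce to statements on single intervals, where such
functions are constant. -/
theorem dyadicFiltration_eq_comap (n : ℕ) :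
    dyadicFiltration n = MeasurableSpace.comap (dyadicIndex n) ⊤ := by
  apply le_antisymm
  · refine MeasurableSpace.generateFrom_le ?_
    rintro _ ⟨k, rfl⟩
    exact ⟨{k}, trivial, preimage_dyadicIndex_singleton n k⟩
  · rintro _ ⟨s, -, rfl⟩
    rw [← biUnion_of_singleton s, preimage_iUnion₂]
    refine MeasurableSet.biUnion s.to_countable fun k _ => ?_
    rw [preimage_dyadicIndex_singleton]
    exact measurableSet_dyadicInterval n k

theorem measurable_comp_dyadicIndex {Z : Type*} [MeasurableSpace Z] (n : ℕ) (c : ℤ → Z) :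
    Measurable[dyadicFiltration n] fun x => c (dyadicIndex n x) := by
  rw [dyadicFiltration_eq_comap]
  exact fun s _ => ⟨c ⁻¹' s, trivial, rfl⟩

theorem exists_eq_comp_dyadicIndex {Z : Type*} [MeasurableSpace Z] [MeasurableSingletonClass Z]
    [Nonempty Z] {n : ℕ} {u : ℝ → Z} (hu : Measurable[dyadicFiltration n] u) :
    ∃ c : ℤ → Z, ∀ x, u x = c (dyadicIndex n x) := by
  rw [dyadicFiltration_eq_comap] at hu
  have := Measurable.factorsThrough (mY := ⊤) hu
  obtain ⟨c, hc⟩ := (Function.factorsThrough_iff u).1 this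
  exact ⟨c, fun x => congrFun hc x⟩

theorem measurable_of_dyadic {Z : Type*} [MeasurableSpace Z] {n : ℕ} {u : ℝ → Z}
    (hu : Measurable[dyadicFiltration n] u) : Measurable u :=
  hu.mono (dyadicFiltration.le n) le_rfl

theorem measurable_dyadic_mono {Z : Type*} [MeasurableSpace Z] {m n : ℕ} (h : m ≤ n) {u : ℝ → Z}
    (hu : Measurable[dyadicFiltration m] u) : Measurable[dyadicFiltration n] u :=
  hu.mono (dyadicFiltration.mono h) le_rfl

theorem measurableSet_cell_dyadic (n : ℕ) (j : ℤ) : MeasurableSet[dyadicFiltration n] (cell j) := by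
  rw [← dyadicInterval_zero]
  exact dyadicFiltration.mono (Nat.zero_le n) _ (measurableSet_dyadicInterval 0 j)

/-- The union of the cells with index in `F`. -/
def cells (F : Finset ℤ) : Set ℝ := ⋃ j ∈ F, cell j

theorem mem_cell_iff {j : ℤ} {x : ℝ} : x ∈ cell j ↔ dyadicIndex 0 x = j := by
  rw [← dyadicInterval_zero, dyadicIndex_eq_iff]

theorem mem_cells_iff {F : Finset ℤ} {x : ℝ} : x ∈ cells F ↔ dyadicIndex 0 x ∈ F := by
  simp [cells, mem_cell_iff]

theorem measurableSet_cells (n : ℕ) (F : Finset ℤ) : MeasurableSet[dyadicFiltration n] (cells F) :=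
  Finset.measurableSet_biUnion F fun j _ => measurableSet_cell_dyadic n j

theorem cell_subset_cells {F : Finset ℤ} {j : ℤ} (hj : j ∈ F) : cell j ⊆ cells F :=
  fun _ hx => mem_cells_iff.2 ((mem_cell_iff.1 hx).symm ▸ hj)

/-- Integer division rounds down, for negative indices too, so it sends an interval to the cell that
contains it. -/
theorem dyadicIndex_zero_eq (n : ℕ) (x : ℝ) : dyadicIndex 0 x = dyadicIndex n x / 2 ^ n := by
  have h2 : (0 : ℝ) < 2 ^ n := by positivity
  have h := mem_dyadicInterval_dyadicIndex n x
  rw [dyadicIndex_eq_iff, dyadicInterval_zero]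
  rw [dyadicInterval, mem_Ico, div_le_iff₀ h2, lt_div_iff₀ h2] at h
  have h1 := Int.ediv_mul_le (dyadicIndex n x) (b := 2 ^ n) (by positivity)
  have h3 := Int.lt_ediv_add_one_mul_self (dyadicIndex n x) (b := 2 ^ n) (by positivity)
  constructor
  · have h4 : (((dyadicIndex n x / 2 ^ n : ℤ) * 2 ^ n : ℤ) : ℝ) ≤ dyadicIndex n x := by
      exact_mod_cast h1
    push_cast at h4
    exact le_of_mul_le_mul_right (h4.trans h.1) h2
  · have h4 : ((dyadicIndex n x + 1 : ℤ) : ℝ) ≤ ((dyadicIndex n x / 2 ^ n : ℤ) + 1) * 2 ^ n := by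
      exact_mod_cast h3
    push_cast at h4
    exact lt_of_mul_lt_mul_right (h.2.trans_le h4) h2.le

theorem dyadicInterval_subset_cell (n : ℕ) (k : ℤ) : dyadicInterval n k ⊆ cell (k / 2 ^ n) := by
  intro x hx
  rw [mem_cell_iff, dyadicIndex_zero_eq n, dyadicIndex_eq_iff.2 hx]

/-- The indices of the dyadic intervals of generation `n` in `cells F`. -/
def indicesIn (n : ℕ) (F : Finset ℤ) : Finset ℤ :=
  F.biUnion fun j => Finset.Ico (j * 2 ^ n) ((j + 1) * 2 ^ n)

theorem mem_indicesIn {n : ℕ} {F : Finset ℤ} {k : ℤ} : k ∈ indicesIn n F ↔ k / 2 ^ n ∈ F := by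
  have h2 : (0 : ℤ) < 2 ^ n := by positivity
  simp only [indicesIn, Finset.mem_biUnion, Finset.mem_Ico]
  constructor
  · rintro ⟨j, hj, h1, h3⟩
    convert hj
    exact le_antisymm (Int.le_of_lt_add_one ((Int.ediv_lt_iff_lt_mul h2).2 h3))
      ((Int.le_ediv_iff_mul_le h2).2 h1)
  · intro h
    exact ⟨_, h, (Int.le_ediv_iff_mul_le h2).1 le_rfl,
      (Int.ediv_lt_iff_lt_mul h2).1 (Int.lt_succ _)⟩

theorem dyadicIndex_mem_indicesIn {n : ℕ} {F : Finset ℤ} {x : ℝ} :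
    dyadicIndex n x ∈ indicesIn n F ↔ x ∈ cells F := by
  rw [mem_indicesIn, mem_cells_iff, dyadicIndex_zero_eq n]

/-- Finitely many cells contain finitely many intervals of generation `n`, so `u` takes finitely
many values there. For finite `P` this settles every integrability question on cells. -/
theorem exists_bound_on_cells {n : ℕ} {u : ℝ → ℝ} (hu : Measurable[dyadicFiltration n] u)
    (F : Finset ℤ) : ∃ M : ℝ, 0 ≤ M ∧ ∀ x ∈ cells F, |u x| ≤ M := by
  obtain ⟨c, hc⟩ := exists_eq_comp_dyadicIndex hu
  refine ⟨∑ k ∈ indicesIn n F, |c k|, Finset.sum_nonneg fun _ _ => abs_nonneg _, fun x hx => ?_⟩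
  rw [hc]
  exact Finset.single_le_sum (f := fun k => |c k|) (fun _ _ => abs_nonneg _)
    (dyadicIndex_mem_indicesIn.2 hx)

variable {P : Measure ℝ}

theorem integrable_of_vanish [IsFiniteMeasure P] {n : ℕ} {u : ℝ → ℝ}
    (hu : Measurable[dyadicFiltration n] u)
    {F : Finset ℤ} (h0 : ∀ x ∉ cells F, u x = 0) : Integrable u P := by
  obtain ⟨M, hM, h⟩ := exists_bound_on_cells hu F
  refine Integrable.of_bound (measurable_of_dyadic hu).aestronglyMeasurable M
    (ae_of_all _ fun x => ?_)
  by_cases hx : x ∈ cells F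
  · exact h x hx
  · simpa [h0 x hx] using hM

theorem integrableOn_cells [IsFiniteMeasure P] {n : ℕ} {u : ℝ → ℝ}
    (hu : Measurable[dyadicFiltration n] u) (F : Finset ℤ) : IntegrableOn u (cells F) P := by
  rw [← integrable_indicator_iff (dyadicFiltration.le n _ (measurableSet_cells n F))]
  exact integrable_of_vanish (hu.indicator (measurableSet_cells n F)) (F := F)
    fun x hx => indicator_of_notMem hx _

theorem integrableOn_dyadicInterval [IsFiniteMeasure P] {n : ℕ} {u : ℝ → ℝ}
    (hu : Measurable[dyadicFiltration n] u) (m : ℕ) (k : ℤ) :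
    IntegrableOn u (dyadicInterval m k) P :=
  (integrableOn_cells hu {k / 2 ^ m}).mono_set
    ((dyadicInterval_subset_cell m k).trans (cell_subset_cells (by simp)))

theorem lintegral_eq_tsum_dyadic (n : ℕ) (u : ℝ → ℝ≥0∞) :
    ∫⁻ x, u x ∂P = ∑' k, ∫⁻ x in dyadicInterval n k, u x ∂P := by
  rw [← lintegral_iUnion (measurableSet_dyadicInterval' n) (pairwise_disjoint_dyadicInterval n),
    iUnion_dyadicInterval, Measure.restrict_univ]

theorem hasSum_integral_dyadic (n : ℕ) {u : ℝ → ℝ} (hu : Integrable u P) :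
    HasSum (fun k => ∫ x in dyadicInterval n k, u x ∂P) (∫ x, u x ∂P) := by
  have := hasSum_integral_iUnion (measurableSet_dyadicInterval' n)
    (pairwise_disjoint_dyadicInterval n) (hu.integrableOn (s := ⋃ k, dyadicInterval n k))
  rwa [iUnion_dyadicInterval, Measure.restrict_univ] at this

/-- There are countably many dyadic intervals, so the union of the null ones is null. Off this set,
pointwise division by the mass of an interval is legitimate. -/
theorem ae_measure_dyadicInterval_ne_zero (P : Measure ℝ) :
    ∀ᵐ x ∂P, ∀ n, P (dyadicInterval n (dyadicIndex n x)) ≠ 0 := by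
  rw [ae_all_iff]
  intro n
  have : {x | ¬ P (dyadicInterval n (dyadicIndex n x)) ≠ 0} ⊆
      ⋃ k ∈ {k | P (dyadicInterval n k) = 0}, dyadicInterval n k := by
    intro x hx
    simp only [ne_eq, not_not, mem_ofPred_eq] at hx
    exact mem_biUnion hx (mem_dyadicInterval_dyadicIndex n x)
  exact measure_mono_null this ((measure_biUnion_null_iff (to_countable _)).2 fun k hk => hk)

/-- Testing against a `ℱ n`-measurable function reduces to integrals over dyadic intervals. -/
theorem integral_mul_eq_zero {n : ℕ} {v u : ℝ → ℝ} (hv : Measurable[dyadicFiltration n] v)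
    (hu : ∀ k, ∫ x in dyadicInterval n k, u x ∂P = 0) (hvu : Integrable (fun x => v x * u x) P) :
    ∫ x, v x * u x ∂P = 0 := by
  obtain ⟨c, hc⟩ := exists_eq_comp_dyadicIndex hv
  refine (hasSum_integral_dyadic n hvu).unique ?_
  convert hasSum_zero with k
  rw [setIntegral_congr_fun (g := fun x => c k * u x) (measurableSet_dyadicInterval' n k)
    (fun x hx => by simp [hc, dyadicIndex_eq_iff.2 hx]), integral_const_mul, hu, mul_zero]

/-! ### Conditional expectations of nonnegative functions -/

section CondLExp

variable [IsFiniteMeasure P]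

theorem lintegral_mul_condLExp {n : ℕ} {v u : ℝ → ℝ≥0∞} (hv : Measurable[dyadicFiltration n] v)
    (hu : Measurable u) :
    ∫⁻ x, v x * condLExp (dyadicFiltration n) P u x ∂P = ∫⁻ x, v x * u x ∂P := by
  obtain ⟨c, hc⟩ := exists_eq_comp_dyadicIndex hv
  rw [lintegral_eq_tsum_dyadic n, lintegral_eq_tsum_dyadic n]
  congr 1 with k
  have key : ∀ w : ℝ → ℝ≥0∞, Measurable w →
      ∫⁻ x in dyadicInterval n k, v x * w x ∂P = c k * ∫⁻ x in dyadicInterval n k, w x ∂P := by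
    intro w hw
    rw [← lintegral_const_mul _ hw]
    exact setLIntegral_congr_fun (measurableSet_dyadicInterval' n k)
      fun x hx => by simp [hc, dyadicIndex_eq_iff.2 hx]
  rw [key _ (measurable_condLExp' _ _ _), key _ hu,
    setLIntegral_condLExp (dyadicFiltration.le n) P u (measurableSet_dyadicInterval n k)]

theorem condLExp_mul_left {n : ℕ} {v u : ℝ → ℝ≥0∞} (hv : Measurable[dyadicFiltration n] v)
    (hu : Measurable u) : condLExp (dyadicFiltration n) P (fun x => v x * u x) =ᵐ[P]
      fun x => v x * condLExp (dyadicFiltration n) P u x := by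
  symm
  refine ae_eq_condLExp (dyadicFiltration.le n) P _ (hv.mul (measurable_condLExp _ _ _))
    fun s hs => ?_
  have hs' := dyadicFiltration.le n s hs
  rw [← lintegral_indicator hs', ← lintegral_indicator hs']
  simpa only [indicator_mul_left] using lintegral_mul_condLExp (P := P) (hv.indicator hs) hu

/-- The conditional expectation is constant on each interval. The value ∞ on an interval of positive
mass would contradict the integrability of `u ^ 2` there. -/
theorem condLExp_ne_top_of_dyadic {m : ℕ} (n : ℕ) {u : ℝ → ℝ}
    (hu : Measurable[dyadicFiltration m] u) :
    ∀ᵐ x ∂P, condLExp (dyadicFiltration n) P (fun y => ‖u y‖ₑ ^ 2) x ≠ ∞ := by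
  obtain ⟨c, hc⟩ := exists_eq_comp_dyadicIndex
    (measurable_condLExp (dyadicFiltration n) P fun y => ‖u y‖ₑ ^ 2)
  filter_upwards [ae_measure_dyadicInterval_ne_zero P] with x hx htop
  set k := dyadicIndex n x with hk
  have h1 := setLIntegral_condLExp (dyadicFiltration.le n) P (fun y => ‖u y‖ₑ ^ 2)
    (measurableSet_dyadicInterval n k)
  rw [setLIntegral_congr_fun (g := fun _ => ∞) (measurableSet_dyadicInterval' n k)
    (fun y hy => by rw [hc, dyadicIndex_eq_iff.2 hy, hk, ← hc, htop])] at h1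
  have hi : IntegrableOn (fun y => u y ^ 2) (dyadicInterval n k) P :=
    integrableOn_dyadicInterval (hu.pow_const 2) n k
  have h2 := hi.2
  rw [HasFiniteIntegral] at h2
  simp only [enorm_pow] at h2
  rw [← h1, setLIntegral_const, ENNReal.top_mul (hx n)] at h2
  exact lt_irrefl _ h2

/-- The conditional Cauchy–Schwarz inequality, integrated. -/
theorem lintegral_mul_le_condLExp_sq (n : ℕ) {u v : ℝ → ℝ≥0∞} (hu : Measurable u)
    (hv : Measurable v) :
    ∫⁻ x, u x * v x ∂P ≤ ∫⁻ x, condLExp (dyadicFiltration n) P (fun y => u y ^ 2) x ^ (1 / 2 : ℝ) *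
      condLExp (dyadicFiltration n) P (fun y => v y ^ 2) x ^ (1 / 2 : ℝ) ∂P := by
  rw [lintegral_eq_tsum_dyadic n, lintegral_eq_tsum_dyadic n]
  refine ENNReal.tsum_le_tsum fun k => ?_
  -- On one interval the conditional second moment is a constant `c`, so the ordinary Cauchy–Schwarz
  -- inequality there already has the required form.
  have key : ∀ w : ℝ → ℝ≥0∞, ∃ c : ℝ≥0∞,
      (∀ x ∈ dyadicInterval n k, condLExp (dyadicFiltration n) P (fun y => w y ^ 2) x = c) ∧
      ∫⁻ x in dyadicInterval n k, w x ^ (2 : ℝ) ∂P = c * P (dyadicInterval n k) := by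
    intro w
    obtain ⟨c, hc⟩ := exists_eq_comp_dyadicIndex
      (measurable_condLExp (dyadicFiltration n) P fun y => w y ^ 2)
    refine ⟨c k, fun x hx => by rw [hc, dyadicIndex_eq_iff.2 hx], ?_⟩
    have h1 := setLIntegral_condLExp (dyadicFiltration.le n) P (fun y => w y ^ 2)
      (measurableSet_dyadicInterval n k)
    simp only [ENNReal.rpow_two]
    rw [← h1, setLIntegral_congr_fun (g := fun _ => c k) (measurableSet_dyadicInterval' n k)
      (fun y hy => by rw [hc, dyadicIndex_eq_iff.2 hy]), setLIntegral_const]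
  obtain ⟨a, ha, ha'⟩ := key u
  obtain ⟨b, hb, hb'⟩ := key v
  refine (ENNReal.lintegral_mul_le_Lp_mul_Lq (P.restrict (dyadicInterval n k))
    Real.HolderConjugate.two_two hu.aemeasurable hv.aemeasurable).trans (le_of_eq ?_)
  rw [ha', hb', setLIntegral_congr_fun (g := fun _ => a ^ (1 / 2 : ℝ) * b ^ (1 / 2 : ℝ))
    (measurableSet_dyadicInterval' n k) (fun y hy => by simp only [ha y hy, hb y hy]),
    setLIntegral_const, ENNReal.mul_rpow_of_nonneg _ _ (by norm_num),
    ENNReal.mul_rpow_of_nonneg _ _ (by norm_num), mul_mul_mul_comm, ← ENNReal.rpow_add_of_nonneg _ _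
    (by norm_num) (by norm_num)]
  norm_num

end CondLExp

/-! ### A criterion for dyadic martingales -/

theorem IsDyadicMartingale.measurable_dyadic {f : ℕ → ℝ → ℝ} (hf : IsDyadicMartingale P f) (n : ℕ) :
    Measurable[dyadicFiltration n] (f n) := by
  have hc : ∀ j : ℤ, Measurable[dyadicFiltration n] ((cell j).indicator (f n)) := fun j =>
    ((hf.2 j).1 n).measurable
  intro s hs
  have : f n ⁻¹' s = ⋃ j : ℤ, ((cell j).indicator (f n) ⁻¹' s ∩ cell j) := by
    ext x
    simp only [mem_preimage, mem_iUnion, mem_inter_iff]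
    constructor
    · intro hx
      have hxc : x ∈ cell (dyadicIndex 0 x) := mem_cell_iff.2 rfl
      exact ⟨_, by rwa [indicator_of_mem hxc], hxc⟩
    · rintro ⟨j, hj, hxc⟩
      rwa [indicator_of_mem hxc] at hj
  rw [this]
  exact MeasurableSet.iUnion fun j => (hc j hs).inter (measurableSet_cell_dyadic n j)

theorem IsDyadicMartingale.setIntegral_eq [IsFiniteMeasure P] {f : ℕ → ℝ → ℝ}
    (hf : IsDyadicMartingale P f) {n m : ℕ} (h : n ≤ m) (k : ℤ) :
    ∫ x in dyadicInterval n k, f m x ∂P = ∫ x in dyadicInterval n k, f n x ∂P := by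
  have := (hf.2 (k / 2 ^ n)).setIntegral_eq h (measurableSet_dyadicInterval n k)
  have key : ∀ i, ∫ x in dyadicInterval n k, (cell (k / 2 ^ n)).indicator (f i) x ∂P =
      ∫ x in dyadicInterval n k, f i x ∂P := fun i =>
    setIntegral_congr_fun (measurableSet_dyadicInterval' n k) fun x hx =>
      indicator_of_mem (dyadicInterval_subset_cell n k hx) _
  rw [key, key] at this
  exact this.symm

theorem measurable_dyadic_indicator_one {n : ℕ} {s : Set ℝ}
    (hs : MeasurableSet[dyadicFiltration n] s) :
    Measurable[dyadicFiltration n] (s.indicator (1 : ℝ → ℝ)) :=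
  (@measurable_const ℝ ℝ _ (dyadicFiltration n) 1).indicator hs

/-- Intervals of generation `n` partition ℝ and generate `ℱ n`, so testing one time step on them
suffices; integrability on cells is automatic. -/
theorem isDyadicMartingale_of_setIntegral [IsFiniteMeasure P] {f : ℕ → ℝ → ℝ} (h0 : f 0 = 0)
    (hm : ∀ n, Measurable[dyadicFiltration n] (f n))
    (hi : ∀ n k, ∫ x in dyadicInterval n k, f (n + 1) x ∂P = ∫ x in dyadicInterval n k, f n x ∂P) :
    IsDyadicMartingale P f := by
  refine ⟨h0, fun j => ?_⟩
  have hF : cells {j} = cell j := by simp [cells]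
  have hint : ∀ i, Integrable ((cell j).indicator (f i)) P := fun i => by
    rw [integrable_indicator_iff (measurableSet_cell j), ← hF]
    exact integrableOn_cells (hm i) _
  refine martingale_of_setIntegral_eq_succ
    (fun n => ((hm n).indicator (measurableSet_cell_dyadic n j)).stronglyMeasurable) hint
    fun n s hs => ?_
  have hs' := dyadicFiltration.le n s hs
  symm
  rw [← sub_eq_zero, ← integral_sub (hint _).integrableOn (hint _).integrableOn,
    ← integral_indicator hs']
  -- Integrating over `s` inside the cell is testing against this `ℱ n`-measurable indicator, as in
  -- `integral_mul_eq_zero`.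
  set v : ℝ → ℝ := (s ∩ cell j).indicator 1 with hv
  have hvm : Measurable[dyadicFiltration n] v :=
    measurable_dyadic_indicator_one (hs.inter (measurableSet_cell_dyadic n j))
  have e : (s.indicator fun x => (cell j).indicator (f (n + 1)) x - (cell j).indicator (f n) x) =
      fun x => v x * (f (n + 1) x - f n x) := by
    ext x
    by_cases h1 : x ∈ s <;> by_cases h2 : x ∈ cell j <;> simp [hv, h1, h2]
  rw [e]
  refine integral_mul_eq_zero hvm (fun k => ?_) ?_
  · rw [integral_sub (integrableOn_dyadicInterval (hm _) n k)
      (integrableOn_dyadicInterval (hm _) n k), hi, sub_self]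
  · rw [← e, integrable_indicator_iff hs']
    exact ((hint _).sub (hint _)).integrableOn

theorem mdiff_zero (f : ℕ → ℝ → ℝ) : mdiff f 0 = 0 := by simp [mdiff]

theorem mdiff_succ (f : ℕ → ℝ → ℝ) (n : ℕ) : mdiff f (n + 1) = f (n + 1) - f n := rfl

theorem IsDyadicMartingale.sum_mdiff {f : ℕ → ℝ → ℝ} (hf : IsDyadicMartingale P f) (n : ℕ) :
    ∑ k ∈ Finset.range (n + 1), mdiff f k = f n := by
  induction n with
  | zero => simp [mdiff_zero, hf.1]
  | succ n ih => rw [Finset.sum_range_succ, ih, mdiff_succ, add_sub_cancel]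

theorem IsDyadicMartingale.measurable_mdiff {f : ℕ → ℝ → ℝ} (hf : IsDyadicMartingale P f) (n : ℕ) :
    Measurable[dyadicFiltration n] (mdiff f n) :=
  (hf.measurable_dyadic n).sub (measurable_dyadic_mono (Nat.sub_le n 1) (hf.measurable_dyadic _))

theorem IsDyadicMartingale.setIntegral_mdiff [IsFiniteMeasure P] {f : ℕ → ℝ → ℝ}
    (hf : IsDyadicMartingale P f) (n : ℕ) (k : ℤ) :
    ∫ x in dyadicInterval (n - 1) k, mdiff f n x ∂P = 0 := by
  simp only [mdiff, Pi.sub_apply]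
  rw [integral_sub (integrableOn_dyadicInterval (hf.measurable_dyadic _) _ k)
    (integrableOn_dyadicInterval (hf.measurable_dyadic _) _ k), hf.setIntegral_eq (Nat.sub_le n 1),
    sub_self]

/-! ### Martingale transforms -/

/-- The martingale transform of `f` by the sequence `v`. -/
def transform (v f : ℕ → ℝ → ℝ) (n : ℕ) : ℝ → ℝ :=
  ∑ k ∈ Finset.range (n + 1), v k * mdiff f k

theorem mdiff_transform (v f : ℕ → ℝ → ℝ) (n : ℕ) :
    mdiff (transform v f) n = v n * mdiff f n := by
  cases n with
  | zero => simp [mdiff_zero]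
  | succ n => rw [mdiff_succ, transform, transform, Finset.sum_range_succ, add_sub_cancel_left]

/-- Transforms by predictable sequences are dyadic martingales. -/
theorem IsDyadicMartingale.transform [IsFiniteMeasure P] {f v : ℕ → ℝ → ℝ}
    (hf : IsDyadicMartingale P f) (hv : ∀ n, Measurable[dyadicFiltration (n - 1)] (v n)) :
    IsDyadicMartingale P (transform v f) := by
  have hvd : ∀ n, Measurable[dyadicFiltration n] (v n * mdiff f n) := fun n =>
    (measurable_dyadic_mono (Nat.sub_le n 1) (hv n)).mul (hf.measurable_mdiff n)
  have hm : ∀ n, Measurable[dyadicFiltration n] (DyadicHardy.transform v f n) := by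
    intro n
    have e : DyadicHardy.transform v f n =
        fun x => ∑ k ∈ Finset.range (n + 1), (v k * mdiff f k) x := by
      ext x; simp [DyadicHardy.transform]
    rw [e]
    refine Finset.measurable_fun_sum _ fun k hk => ?_
    exact measurable_dyadic_mono (Nat.lt_succ_iff.1 (Finset.mem_range.1 hk)) (hvd k)
  refine isDyadicMartingale_of_setIntegral (by simp [DyadicHardy.transform, mdiff_zero]) hm
    fun n k => ?_
  rw [← sub_eq_zero, ← integral_sub (integrableOn_dyadicInterval (hm _) _ k)
    (integrableOn_dyadicInterval (hm _) _ k)]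
  obtain ⟨c, hc⟩ := exists_eq_comp_dyadicIndex (hv (n + 1))
  have e : ∀ x ∈ dyadicInterval n k, DyadicHardy.transform v f (n + 1) x -
      DyadicHardy.transform v f n x = c k * mdiff f (n + 1) x := by
    intro x hx
    have := congrFun (mdiff_transform v f (n + 1)) x
    rw [mdiff_succ] at this
    simp only [Pi.sub_apply, Pi.mul_apply] at this
    rw [this, hc, Nat.add_sub_cancel, dyadicIndex_eq_iff.2 hx]
  rw [setIntegral_congr_fun (measurableSet_dyadicInterval' n k) e, integral_const_mul]
  have := hf.setIntegral_mdiff (n + 1) k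
  rw [Nat.add_sub_cancel] at this
  rw [this, mul_zero]

/-- The conditional second moment `E_{n-1} |d_n f|²`. -/
def condVar (P : Measure ℝ) (f : ℕ → ℝ → ℝ) (n : ℕ) : ℝ → ℝ≥0∞ :=
  condLExp (dyadicFiltration (n - 1)) P fun y => ‖mdiff f n y‖ₑ ^ 2

theorem condSq_sq' (P : Measure ℝ) (f : ℕ → ℝ → ℝ) (x : ℝ) :
    condSq P f x ^ 2 = ∑' n, condVar P f n x := condSq_sq P f x

theorem condSq_eq (P : Measure ℝ) (f : ℕ → ℝ → ℝ) (x : ℝ) :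
    condSq P f x = (∑' n, condVar P f n x) ^ (1 / 2 : ℝ) := rfl

theorem measurable_condVar (P : Measure ℝ) (f : ℕ → ℝ → ℝ) (n : ℕ) :
    Measurable[dyadicFiltration (n - 1)] (condVar P f n) := measurable_condLExp _ _ _

theorem IsDyadicMartingale.condVar_ne_top [IsFiniteMeasure P] {f : ℕ → ℝ → ℝ}
    (hf : IsDyadicMartingale P f) : ∀ᵐ x ∂P, ∀ n, condVar P f n x ≠ ∞ :=
  ae_all_iff.2 fun n => condLExp_ne_top_of_dyadic _ (hf.measurable_mdiff n)

theorem IsDyadicMartingale.condVar_transform [IsFiniteMeasure P] {f v : ℕ → ℝ → ℝ}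
    (hf : IsDyadicMartingale P f) (hv : ∀ n, Measurable[dyadicFiltration (n - 1)] (v n)) :
    ∀ᵐ x ∂P, ∀ n, condVar P (DyadicHardy.transform v f) n x = ‖v n x‖ₑ ^ 2 * condVar P f n x := by
  rw [ae_all_iff]
  intro n
  have e : (fun y => ‖mdiff (DyadicHardy.transform v f) n y‖ₑ ^ 2) =
      fun y => ‖v n y‖ₑ ^ 2 * ‖mdiff f n y‖ₑ ^ 2 := by
    ext y; rw [mdiff_transform, Pi.mul_apply, enorm_mul, mul_pow]
  rw [condVar, e]
  exact condLExp_mul_left ((measurable_enorm.comp (hv n)).pow_const 2)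
    ((hf.mdiff_measurable n).enorm.pow_const 2)

theorem condVar_congr {f g : ℕ → ℝ → ℝ} (h : ∀ n, f n =ᵐ[P] g n) :
    ∀ᵐ x ∂P, ∀ n, condVar P f n x = condVar P g n x := by
  rw [ae_all_iff]
  intro n
  refine condLExp_congr_ae ?_
  filter_upwards [h n, h (n - 1)] with x h1 h2
  simp [mdiff, h1, h2]

theorem condSq_congr {f g : ℕ → ℝ → ℝ} (h : ∀ n, f n =ᵐ[P] g n) : condSq P f =ᵐ[P] condSq P g := by
  filter_upwards [condVar_congr h] with x hx
  simp only [condSq_eq, hx]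

/-! ### Orthogonality of martingale differences -/

/-- In the expansion of f_{N+1} g_{N+1} the cross terms f_N d_{N+1}g and g_N d_{N+1}f integrate to
zero, because one factor is `ℱ N`-measurable. The support condition on `f` makes every product
integrable. -/
theorem IsDyadicMartingale.sum_integral_mdiff_mul [IsFiniteMeasure P] {f g : ℕ → ℝ → ℝ}
    (hf : IsDyadicMartingale P f) (hg : IsDyadicMartingale P g) {F : Finset ℤ}
    (h0 : ∀ n, ∀ x ∉ cells F, f n x = 0) (N : ℕ) :
    ∑ n ∈ Finset.range (N + 1), ∫ x, mdiff f n x * mdiff g n x ∂P = ∫ x, f N x * g N x ∂P := by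
  induction N with
  | zero => simp [mdiff_zero, hf.1]
  | succ N ih =>
    have hfm := hf.measurable_dyadic
    have hgm := hg.measurable_dyadic
    have hfm' : Measurable[dyadicFiltration (N + 1)] (f N) :=
      measurable_dyadic_mono (Nat.le_succ N) (hfm N)
    have hgm' : Measurable[dyadicFiltration (N + 1)] (g N) :=
      measurable_dyadic_mono (Nat.le_succ N) (hgm N)
    have hdf := hf.measurable_mdiff (N + 1)
    have hdg := hg.measurable_mdiff (N + 1)
    have h0' : ∀ x ∉ cells F, mdiff f (N + 1) x = 0 := fun x hx => by
      simp [mdiff_succ, h0 _ x hx]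
    have i1 : Integrable (fun x => f N x * mdiff g (N + 1) x) P :=
      integrable_of_vanish (hfm'.mul hdg) (F := F) fun x hx => by simp [h0 _ x hx]
    have i2 : Integrable (fun x => g N x * mdiff f (N + 1) x) P :=
      integrable_of_vanish (hgm'.mul hdf) (F := F) fun x hx => by simp [h0' x hx]
    have i3 : Integrable (fun x => mdiff f (N + 1) x * mdiff g (N + 1) x) P :=
      integrable_of_vanish (hdf.mul hdg) (F := F) fun x hx => by simp [h0' x hx]
    have i4 : Integrable (fun x => f N x * g N x) P :=
      integrable_of_vanish (hfm'.mul hgm') (F := F) fun x hx => by simp [h0 _ x hx]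
    have z1 := integral_mul_eq_zero (hfm N) (fun k => hg.setIntegral_mdiff (N + 1) k) i1
    have z2 := integral_mul_eq_zero (hgm N) (fun k => hf.setIntegral_mdiff (N + 1) k) i2
    rw [Finset.sum_range_succ, ih]
    have e : ∀ x, f (N + 1) x * g (N + 1) x = f N x * g N x +
        mdiff f (N + 1) x * mdiff g (N + 1) x + (f N x * mdiff g (N + 1) x +
          g N x * mdiff f (N + 1) x) := fun x => by
      simp only [mdiff_succ, Pi.sub_apply]; ring
    have i5 := i4.add i3
    have i6 := i1.add i2
    simp only [Pi.add_def] at i5 i6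
    simp only [e]
    rw [integral_add i5 i6, integral_add i4 i3, integral_add i1 i2, z1, z2]
    simp

/-! ### Finite martingales -/

/-- `f` is constant from time `N` on and vanishes off `cells F`. -/
def IsFiniteMartingale (f : ℕ → ℝ → ℝ) (N : ℕ) (F : Finset ℤ) : Prop :=
  (∀ n, N ≤ n → f n = f N) ∧ ∀ n, ∀ x ∉ cells F, f n x = 0

theorem IsFiniteMartingale.mdiff_eq_zero {f : ℕ → ℝ → ℝ} {N : ℕ} {F : Finset ℤ}
    (h : IsFiniteMartingale f N F) {n : ℕ} (hn : N < n) : mdiff f n = 0 := by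
  rw [mdiff, h.1 n hn.le, h.1 (n - 1) (by omega), sub_self]

theorem isFiniteMartingale_transform {f v : ℕ → ℝ → ℝ} {N : ℕ} {F : Finset ℤ}
    (hN : ∀ n, N < n → v n = 0) (hF : ∀ n, ∀ x ∉ cells F, v n x = 0) :
    IsFiniteMartingale (transform v f) N F := by
  refine ⟨fun n hn => ?_, fun n x hx => ?_⟩
  · refine (Finset.sum_subset (Finset.range_mono (by omega)) fun k _ hk => ?_).symm
    rw [hN k (by simpa using hk), zero_mul]
  · rw [transform, Finset.sum_apply]
    exact Finset.sum_eq_zero fun k _ => by simp [hF k x hx]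

/-- The `L_{p,q}` norm for finite exponents. -/
theorem amalgamNorm_eq {p q : ℝ≥0∞} (hp : p ≠ 0) (hp' : p ≠ ∞) (hq : q ≠ 0) (hq' : q ≠ ∞)
    (u : ℝ → ℝ≥0∞) : amalgamNorm P p q u = (∑' j : ℤ,
      (∫⁻ x in cell j, u x ^ p.toReal ∂P) ^ (q.toReal / p.toReal)) ^ (1 / q.toReal) := by
  rw [amalgamNorm, eLpNorm_eq_lintegral_rpow_enorm_toReal hq hq', lintegral_count]
  congr 2 with j
  rw [eLpNorm_eq_lintegral_rpow_enorm_toReal hp hp', enorm_eq_self, ← ENNReal.rpow_mul]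
  simp only [enorm_eq_self]
  congr 1
  ring

theorem amalgamNorm_lt_top [IsFiniteMeasure P] {p q : ℝ≥0∞} (hp : p ≠ 0) (hp' : p ≠ ∞) (hq : q ≠ 0)
    (hq' : q ≠ ∞) {u : ℝ → ℝ≥0∞} {F : Finset ℤ} {M : ℝ≥0∞} (hM : M ≠ ∞)
    (h1 : ∀ᵐ x ∂P, u x ≤ M) (h0 : ∀ᵐ x ∂P, x ∉ cells F → u x = 0) : amalgamNorm P p q u < ∞ := by
  have hp0 : 0 < p.toReal := ENNReal.toReal_pos hp hp'
  have hq0 : 0 < q.toReal := ENNReal.toReal_pos hq hq'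
  rw [amalgamNorm_eq hp hp' hq hq']
  refine ENNReal.rpow_lt_top_of_nonneg (by positivity) ?_
  rw [tsum_eq_sum (s := F)]
  · refine (ENNReal.sum_lt_top.2 fun j _ => ENNReal.rpow_lt_top_of_nonneg (by positivity) ?_).ne
    refine ne_top_of_le_ne_top ?_ (lintegral_mono_ae
      (g := fun _ => M ^ p.toReal) (ae_restrict_of_ae ?_))
    · rw [setLIntegral_const]
      exact ENNReal.mul_ne_top (ENNReal.rpow_ne_top_of_nonneg hp0.le hM) (measure_ne_top _ _)
    · filter_upwards [h1] with x hx
      gcongr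
  · intro j hj
    have : ∫⁻ x in cell j, u x ^ p.toReal ∂P = 0 := by
      rw [setLIntegral_congr_fun_ae (g := fun _ => 0) (measurableSet_cell j)]
      · simp
      · filter_upwards [h0] with x hx hxj
        rw [hx, ENNReal.zero_rpow_of_pos hp0]
        rw [mem_cells_iff, mem_cell_iff.1 hxj]
        exact hj
    rw [this, ENNReal.zero_rpow_of_pos (by positivity)]

theorem condVar_eq_zero_of_mdiff {f : ℕ → ℝ → ℝ} {n : ℕ} (h : mdiff f n = 0) :
    condVar P f n = 0 := by
  have : (fun y => ‖mdiff f n y‖ₑ ^ 2) = 0 := by ext; simp [h]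
  rw [condVar, this, condLExp_zero]

/-- Such an `f` is its own transform by the indicator of `cells F`, and this factor is measurable at
every generation, so it comes out of the conditional expectation. -/
theorem IsDyadicMartingale.condVar_eq_zero_off [IsFiniteMeasure P] {f : ℕ → ℝ → ℝ}
    (hf : IsDyadicMartingale P f) {F : Finset ℤ} (h0 : ∀ n, ∀ x ∉ cells F, f n x = 0) :
    ∀ᵐ x ∂P, x ∉ cells F → ∀ n, condVar P f n x = 0 := by
  have hv : ∀ n : ℕ, Measurable[dyadicFiltration (n - 1)] ((cells F).indicator (1 : ℝ → ℝ)) :=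
    fun n => measurable_dyadic_indicator_one (measurableSet_cells _ F)
  have e : DyadicHardy.transform (fun _ => (cells F).indicator 1) f = f := by
    ext n x
    rw [← congrFun (hf.sum_mdiff n) x, DyadicHardy.transform]
    simp only [Finset.sum_apply, Pi.mul_apply]
    refine Finset.sum_congr rfl fun k _ => ?_
    by_cases hx : x ∈ cells F
    · simp [hx]
    · simp [mdiff, h0 _ x hx]
  have := hf.condVar_transform hv
  rw [e] at this
  filter_upwards [this] with x hx hxF n
  rw [hx, indicator_of_notMem hxF]
  simp

theorem IsDyadicMartingale.mem_of_finite [IsFiniteMeasure P] {p q : ℝ≥0∞} [Fact (1 ≤ p)]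
    [Fact (1 ≤ q)] (hp' : p ≠ ∞) (hq' : q ≠ ∞) {f : ℕ → ℝ → ℝ}
    (hf : IsDyadicMartingale P f) {N : ℕ} {F : Finset ℤ} (h : IsFiniteMartingale f N F) :
    f ∈ hsSubmodule P p q := by
  refine ⟨hf, ?_⟩
  have hp : p ≠ 0 := (zero_lt_one.trans_le (Fact.out : 1 ≤ p)).ne'
  have hq : q ≠ 0 := (zero_lt_one.trans_le (Fact.out : 1 ≤ q)).ne'
  -- Only times up to `N` contribute to s(f)². The sum is measurable at generation `N`, hence
  -- bounded on `cells F`.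
  have hT : Measurable[dyadicFiltration N] fun x =>
      ∑ n ∈ Finset.range (N + 1), (condVar P f n x).toReal := by
    refine Finset.measurable_fun_sum _ fun n hn => ?_
    have := Finset.mem_range.1 hn
    exact measurable_dyadic_mono (by omega) (measurable_condVar P f n).ennreal_toReal
  obtain ⟨M, hM, hb⟩ := exists_bound_on_cells hT F
  have hoff := hf.condVar_eq_zero_off h.2
  refine amalgamNorm_lt_top (F := F) hp hp' hq hq' (M := ENNReal.ofReal M ^ (1 / 2 : ℝ))
    (by finiteness) ?_ ?_
  · filter_upwards [hoff, hf.condVar_ne_top] with x hx hfin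
    rw [condSq_eq]
    gcongr
    by_cases hxF : x ∈ cells F
    · rw [tsum_eq_sum (s := Finset.range (N + 1))]
      · rw [← ENNReal.ofReal_toReal (ENNReal.sum_ne_top.2 fun n _ => hfin n),
          ENNReal.toReal_sum fun n _ => hfin n]
        exact ENNReal.ofReal_le_ofReal ((le_abs_self _).trans (hb x hxF))
      · intro n hn
        rw [condVar_eq_zero_of_mdiff (h.mdiff_eq_zero (by simpa using hn)), Pi.zero_apply]
    · simp [hx hxF]
  · filter_upwards [hoff] with x hx hxF
    simp [condSq_eq, hx hxF]

/-! ### The Hölder inequality and boundedness of the pairing -/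

theorem tsum_mul_le_Lp_mul_Lq {ι : Type*} {p q : ℝ} (hpq : p.HolderConjugate q)
    (a b : ι → ℝ≥0∞) :
    ∑' i, a i * b i ≤ (∑' i, a i ^ p) ^ (1 / p) * (∑' i, b i ^ q) ^ (1 / q) := by
  let _ : MeasurableSpace ι := ⊤
  have := ENNReal.lintegral_mul_le_Lp_mul_Lq Measure.count hpq (f := a) (g := b)
    measurable_from_top.aemeasurable measurable_from_top.aemeasurable
  simpa only [lintegral_count, Pi.mul_apply] using this

theorem lintegral_eq_tsum_cell (u : ℝ → ℝ≥0∞) :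
    ∫⁻ x, u x ∂P = ∑' j, ∫⁻ x in cell j, u x ∂P := by
  simpa only [dyadicInterval_zero] using lintegral_eq_tsum_dyadic 0 u

theorem lintegral_mul_le_amalgamNorm {p q p' q' : ℝ≥0∞}
    (hp : p.toReal.HolderConjugate p'.toReal) (hq : q.toReal.HolderConjugate q'.toReal)
    {u v : ℝ → ℝ≥0∞} (hu : Measurable u) (hv : Measurable v) :
    ∫⁻ x, u x * v x ∂P ≤ amalgamNorm P p q u * amalgamNorm P p' q' v := by
  have p1 := ENNReal.toReal_pos_iff.1 hp.pos
  have p2 := ENNReal.toReal_pos_iff.1 hp.symm.pos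
  have q1 := ENNReal.toReal_pos_iff.1 hq.pos
  have q2 := ENNReal.toReal_pos_iff.1 hq.symm.pos
  rw [amalgamNorm_eq p1.1.ne' p1.2.ne q1.1.ne' q1.2.ne,
    amalgamNorm_eq p2.1.ne' p2.2.ne q2.1.ne' q2.2.ne, lintegral_eq_tsum_cell]
  refine (ENNReal.tsum_le_tsum fun j => ENNReal.lintegral_mul_le_Lp_mul_Lq
    (P.restrict (cell j)) hp hu.aemeasurable hv.aemeasurable).trans
    ((tsum_mul_le_Lp_mul_Lq hq _ _).trans (le_of_eq ?_))
  simp only [← ENNReal.rpow_mul, one_div_mul_eq_div]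

/-- Conditional Cauchy–Schwarz for each n, Cauchy–Schwarz in n, then Hölder in the amalgam space.
The constant is 1. -/
theorem lintegral_tsum_mdiff_mul_le [IsFiniteMeasure P] {p q p' q' : ℝ≥0∞}
    (hp : p.toReal.HolderConjugate p'.toReal) (hq : q.toReal.HolderConjugate q'.toReal)
    {f g : ℕ → ℝ → ℝ} (hf : IsDyadicMartingale P f) (hg : IsDyadicMartingale P g) :
    ∫⁻ x, ∑' n : ℕ, ‖mdiff f n x * mdiff g n x‖ₑ ∂P ≤
      amalgamNorm P p q (condSq P f) * amalgamNorm P p' q' (condSq P g) := by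
  have hfm := hf.mdiff_measurable
  have hgm := hg.mdiff_measurable
  have hα : ∀ n, Measurable (condVar P f n) := fun n =>
    measurable_of_dyadic (measurable_condVar P f n)
  have hβ : ∀ n, Measurable (condVar P g n) := fun n =>
    measurable_of_dyadic (measurable_condVar P g n)
  refine le_trans ?_ (lintegral_mul_le_amalgamNorm hp hq (measurable_condSq P f)
    (measurable_condSq P g))
  calc ∫⁻ x, ∑' n : ℕ, ‖mdiff f n x * mdiff g n x‖ₑ ∂P
      = ∑' n : ℕ, ∫⁻ x, ‖mdiff f n x‖ₑ * ‖mdiff g n x‖ₑ ∂P := by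
        simp only [enorm_mul]
        exact lintegral_tsum fun n => ((hfm n).enorm.mul (hgm n).enorm).aemeasurable
    _ ≤ ∑' n : ℕ, ∫⁻ x, condVar P f n x ^ (1 / 2 : ℝ) * condVar P g n x ^ (1 / 2 : ℝ) ∂P :=
        ENNReal.tsum_le_tsum fun n => lintegral_mul_le_condLExp_sq (n - 1) (hfm n).enorm
          (hgm n).enorm
    _ = ∫⁻ x, ∑' n : ℕ, condVar P f n x ^ (1 / 2 : ℝ) * condVar P g n x ^ (1 / 2 : ℝ) ∂P := by
        exact (lintegral_tsum fun n =>
          (((hα n).pow_const _).mul ((hβ n).pow_const _)).aemeasurable).symm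
    _ ≤ ∫⁻ x, condSq P f x * condSq P g x ∂P := by
        refine lintegral_mono fun x => ?_
        refine (tsum_mul_le_Lp_mul_Lq Real.HolderConjugate.two_two _ _).trans (le_of_eq ?_)
        simp only [← ENNReal.rpow_mul, condSq_eq]
        norm_num

/-- The duality pairing `E ∑ₙ d_n f d_n g`. -/
def pairing (P : Measure ℝ) (f g : ℕ → ℝ → ℝ) : ℝ :=
  ∫ x, ∑' n : ℕ, mdiff f n x * mdiff g n x ∂P

section Pairing

variable {p q p' q' : ℝ≥0∞} [Fact (1 ≤ p)] [Fact (1 ≤ q)] [Fact (1 ≤ p')]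
  [Fact (1 ≤ q')]

theorem measurable_mdiff_mul (f : HsMartingale P p q) (g : HsMartingale P p' q') (n : ℕ) :
    Measurable fun x => mdiff f.seq n x * mdiff g.seq n x :=
  (f.seq_mem.1.mdiff_measurable n).mul (g.seq_mem.1.mdiff_measurable n)

theorem HsMartingale.mdiff_add (f g : HsMartingale P p q) (n : ℕ) (x : ℝ) :
    mdiff (f + g).seq n x = mdiff f.seq n x + mdiff g.seq n x :=
  congrFun (DyadicHardy.mdiff_add f.seq g.seq n) x

theorem HsMartingale.mdiff_smul (c : ℝ) (f : HsMartingale P p q) (n : ℕ) (x : ℝ) :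
    mdiff (c • f).seq n x = c * mdiff f.seq n x :=
  congrFun (DyadicHardy.mdiff_smul c f.seq n) x

variable [IsFiniteMeasure P]

theorem lintegral_tsum_lt_top (hp : p.toReal.HolderConjugate p'.toReal)
    (hq : q.toReal.HolderConjugate q'.toReal)
    (f : HsMartingale P p q) (g : HsMartingale P p' q') :
    ∫⁻ x, ∑' n : ℕ, ‖mdiff f.seq n x * mdiff g.seq n x‖ₑ ∂P < ∞ :=
  (lintegral_tsum_mdiff_mul_le hp hq f.seq_mem.1 g.seq_mem.1).trans_lt
    (ENNReal.mul_lt_top f.seq_mem.2 g.seq_mem.2)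

theorem tsum_lintegral_lt_top (hp : p.toReal.HolderConjugate p'.toReal)
    (hq : q.toReal.HolderConjugate q'.toReal)
    (f : HsMartingale P p q) (g : HsMartingale P p' q') :
    ∑' n : ℕ, ∫⁻ x, ‖mdiff f.seq n x * mdiff g.seq n x‖ₑ ∂P < ∞ := by
  rw [← lintegral_tsum fun n => (measurable_mdiff_mul f g n).enorm.aemeasurable]
  exact lintegral_tsum_lt_top hp hq f g

theorem integrable_mdiff_mul (hp : p.toReal.HolderConjugate p'.toReal)
    (hq : q.toReal.HolderConjugate q'.toReal)
    (f : HsMartingale P p q) (g : HsMartingale P p' q') (n : ℕ) :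
    Integrable (fun x => mdiff f.seq n x * mdiff g.seq n x) P :=
  ⟨(measurable_mdiff_mul f g n).aestronglyMeasurable,
    (ENNReal.le_tsum n).trans_lt (tsum_lintegral_lt_top hp hq f g)⟩

/-- Absolute convergence allows sum and integral to be exchanged. Bilinearity of the pairing and its
values on finite martingales are then read off term by term, by uniqueness of sums. -/
theorem hasSum_pairing (hp : p.toReal.HolderConjugate p'.toReal)
    (hq : q.toReal.HolderConjugate q'.toReal)
    (f : HsMartingale P p q) (g : HsMartingale P p' q') :
    HasSum (fun n => ∫ x, mdiff f.seq n x * mdiff g.seq n x ∂P) (pairing P f.seq g.seq) := by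
  refine hasSum_integral_of_summable_integral_norm (integrable_mdiff_mul hp hq f g) ?_
  refine (ENNReal.summable_toReal (tsum_lintegral_lt_top hp hq f g).ne).congr fun n => ?_
  rw [integral_norm_eq_lintegral_enorm (measurable_mdiff_mul f g n).aestronglyMeasurable]

theorem norm_pairing_le (hp : p.toReal.HolderConjugate p'.toReal)
    (hq : q.toReal.HolderConjugate q'.toReal)
    (f : HsMartingale P p q) (g : HsMartingale P p' q') :
    ‖pairing P f.seq g.seq‖ ≤ ‖g‖ * ‖f‖ := by
  have h1 : ‖pairing P f.seq g.seq‖ₑ ≤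
      amalgamNorm P p q (condSq P f.seq) * amalgamNorm P p' q' (condSq P g.seq) := by
    refine (enorm_integral_le_lintegral_enorm _).trans (le_trans ?_
      (lintegral_tsum_mdiff_mul_le hp hq f.seq_mem.1 g.seq_mem.1))
    exact lintegral_mono fun x => enorm_tsum_le_tsum_enorm
  have h2 := ENNReal.toReal_mono (ENNReal.mul_ne_top f.seq_mem.2.ne g.seq_mem.2.ne) h1
  rw [toReal_enorm, ENNReal.toReal_mul] at h2
  rw [mul_comm]
  exact h2

/-- The pairing as a bounded bilinear map. -/
def pairingCLM (hp : p.toReal.HolderConjugate p'.toReal)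
    (hq : q.toReal.HolderConjugate q'.toReal) :
    HsMartingale P p' q' →L[ℝ] HsMartingale P p q →L[ℝ] ℝ :=
  LinearMap.mkContinuous₂ (LinearMap.mk₂ ℝ (fun g f => pairing P f.seq g.seq)
    (fun g₁ g₂ f => by
      refine (hasSum_pairing hp hq f (g₁ + g₂)).unique ?_
      simpa only [HsMartingale.mdiff_add, mul_add, integral_add (integrable_mdiff_mul hp hq f g₁ _)
        (integrable_mdiff_mul hp hq f g₂ _)] using
        (hasSum_pairing hp hq f g₁).add (hasSum_pairing hp hq f g₂))
    (fun c g f => by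
      refine (hasSum_pairing hp hq f (c • g)).unique ?_
      simpa only [HsMartingale.mdiff_smul, mul_left_comm _ c, smul_eq_mul, integral_const_mul] using
        (hasSum_pairing hp hq f g).mul_left c)
    (fun g f₁ f₂ => by
      refine (hasSum_pairing hp hq (f₁ + f₂) g).unique ?_
      simpa only [HsMartingale.mdiff_add, add_mul, integral_add (integrable_mdiff_mul hp hq f₁ g _)
        (integrable_mdiff_mul hp hq f₂ g _)] using
        (hasSum_pairing hp hq f₁ g).add (hasSum_pairing hp hq f₂ g))
    (fun c g f => by
      refine (hasSum_pairing hp hq (c • f) g).unique ?_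
      simpa only [HsMartingale.mdiff_smul, mul_assoc, smul_eq_mul, integral_const_mul] using
        (hasSum_pairing hp hq f g).mul_left c)) 1
    fun g f => by simpa using norm_pairing_le hp hq f g

theorem pairingCLM_apply (hp : p.toReal.HolderConjugate p'.toReal)
    (hq : q.toReal.HolderConjugate q'.toReal) (g : HsMartingale P p' q') (f : HsMartingale P p q) :
    pairingCLM hp hq g f = pairing P f.seq g.seq := rfl

end Pairing

/-! ### Power sums -/

/-- By homogeneity this compares 1 - y^θ with 1 - y for y = s/t in [0, 1]. One side is Bernoulli's
inequality, the other compares y^θ with y; they swap roles at θ = 1. -/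
theorem rpow_sub_rpow_bounds {θ s t : ℝ} (hθ : 0 < θ) (hs : 0 ≤ s) (hst : s ≤ t) :
    min 1 θ * ((t - s) * t ^ (θ - 1)) ≤ t ^ θ - s ^ θ ∧
      t ^ θ - s ^ θ ≤ max 1 θ * ((t - s) * t ^ (θ - 1)) := by
  rcases (hs.trans hst).eq_or_lt with h0 | ht
  · obtain rfl : s = 0 := le_antisymm (h0 ▸ hst) hs
    subst h0
    simp
  obtain ⟨y, hy0, hy1, rfl⟩ : ∃ y, 0 ≤ y ∧ y ≤ 1 ∧ s = y * t :=
    ⟨s / t, by positivity, (div_le_one ht).2 hst, by field_simp⟩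
  have e1 : (t - y * t) * t ^ (θ - 1) = (1 - y) * t ^ θ := by
    rw [Real.rpow_sub_one ht.ne']; field_simp
  have e2 : t ^ θ - (y * t) ^ θ = (1 - y ^ θ) * t ^ θ := by
    rw [Real.mul_rpow hy0 ht.le]; ring
  rw [e1, e2, ← mul_assoc, ← mul_assoc]
  have htθ : 0 ≤ t ^ θ := by positivity
  have e3 : (1 : ℝ) + (y - 1) = y := by ring
  rcases le_total 1 θ with h | h
  · have h1 := one_add_mul_self_le_rpow_one_add (s := y - 1) (by linarith) h
    have h2 := Real.rpow_le_rpow_of_exponent_ge_of_imp hy0 hy1 h (by intros; simp_all)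
    rw [Real.rpow_one] at h2
    rw [e3] at h1
    rw [min_eq_left h, max_eq_right h]
    constructor <;> refine mul_le_mul_of_nonneg_right ?_ htθ <;> linarith
  · have h1 := rpow_one_add_le_one_add_mul_self (s := y - 1) (by linarith) hθ.le h
    have h2 := Real.rpow_le_rpow_of_exponent_ge_of_imp hy0 hy1 h (by intros; linarith)
    rw [Real.rpow_one] at h2
    rw [e3] at h1
    rw [min_eq_right h, max_eq_left h]
    constructor <;> refine mul_le_mul_of_nonneg_right ?_ htθ <;> linarith

/-- The preceding bounds, applied to consecutive partial sums, telescope. This is a discrete form of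
∫ θ S^{θ-1} dS = S^θ. -/
theorem partial_sum_rpow_bounds {a : ℕ → ℝ} (ha : ∀ n, 0 ≤ a n) {θ : ℝ} (hθ : 0 < θ) (N : ℕ) :
    min 1 θ * ∑ n ∈ Finset.range (N + 1), a n * (∑ k ∈ Finset.range (n + 1), a k) ^ (θ - 1) ≤
        (∑ k ∈ Finset.range (N + 1), a k) ^ θ ∧
      (∑ k ∈ Finset.range (N + 1), a k) ^ θ ≤
        max 1 θ * ∑ n ∈ Finset.range (N + 1),
          a n * (∑ k ∈ Finset.range (n + 1), a k) ^ (θ - 1) := by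
  induction N with
  | zero =>
    have := rpow_sub_rpow_bounds hθ le_rfl (ha 0)
    simpa [Real.zero_rpow hθ.ne'] using this
  | succ N ih =>
    have hS : 0 ≤ ∑ k ∈ Finset.range (N + 1), a k := Finset.sum_nonneg fun k _ => ha k
    have h := rpow_sub_rpow_bounds (t := ∑ k ∈ Finset.range (N + 1 + 1), a k) hθ hS
      (by rw [Finset.sum_range_succ _ (N + 1)]; linarith [ha (N + 1)])
    have e : ∑ k ∈ Finset.range (N + 1 + 1), a k - ∑ k ∈ Finset.range (N + 1), a k = a (N + 1) := by
      rw [Finset.sum_range_succ _ (N + 1)]; ring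
    rw [e] at h
    rw [Finset.sum_range_succ (fun n => a n * (∑ k ∈ Finset.range (n + 1), a k) ^ (θ - 1)), mul_add,
      mul_add]
    constructor <;> linarith [ih.1, ih.2, h.1, h.2]

/-! ### The lower bound -/

/-- A nonnegative predictable weight may be tested against |d_n g|² or its conditional expectation
alike. Passing to real values loses nothing, since the conditional variance is finite almost
everywhere. -/
theorem IsDyadicMartingale.integral_mul_condVar [IsFiniteMeasure P] {g : ℕ → ℝ → ℝ}
    (hg : IsDyadicMartingale P g) {n : ℕ} {v : ℝ → ℝ} (hv : Measurable[dyadicFiltration (n - 1)] v)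
    (hv0 : ∀ x, 0 ≤ v x) :
    ∫ x, v x * (condVar P g n x).toReal ∂P = ∫ x, v x * mdiff g n x ^ 2 ∂P := by
  have hvm := measurable_of_dyadic hv
  have hgm := hg.mdiff_measurable n
  have hcm := measurable_of_dyadic (measurable_condVar P g n)
  rw [integral_eq_lintegral_of_nonneg_ae (ae_of_all _ fun x => by have := hv0 x; positivity)
    (by fun_prop), integral_eq_lintegral_of_nonneg_ae
    (ae_of_all _ fun x => by have := hv0 x; positivity) (by fun_prop)]
  congr 1
  have h := lintegral_mul_condLExp (P := P) (n := n - 1) (v := fun x => ENNReal.ofReal (v x))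
    (u := fun y => ‖mdiff g n y‖ₑ ^ 2) (ENNReal.measurable_ofReal.comp hv) (hgm.enorm.pow_const 2)
  refine Eq.trans (lintegral_congr_ae ?_) (h.trans (lintegral_congr fun x => ?_))
  · filter_upwards [hg.condVar_ne_top] with x hx
    rw [ENNReal.ofReal_mul (hv0 x), ENNReal.ofReal_toReal (hx n)]
    rfl
  · rw [ENNReal.ofReal_mul (hv0 x), ← sq_abs, ENNReal.ofReal_pow (abs_nonneg _),
      ← Real.norm_eq_abs, ofReal_norm]

/-- The partial sums of the conditional square function, squared. -/
def partialSq (P : Measure ℝ) (g : ℕ → ℝ → ℝ) (n : ℕ) (x : ℝ) : ℝ :=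
  ∑ k ∈ Finset.range (n + 1), (condVar P g k x).toReal

theorem partialSq_nonneg (g : ℕ → ℝ → ℝ) (n : ℕ) (x : ℝ) : 0 ≤ partialSq P g n x :=
  Finset.sum_nonneg fun _ _ => ENNReal.toReal_nonneg

/-- The index `n - 1` is essential: it makes powers of S_n admissible as transform weights at time
`n`. -/
theorem measurable_partialSq (P : Measure ℝ) (g : ℕ → ℝ → ℝ) (n : ℕ) :
    Measurable[dyadicFiltration (n - 1)] (partialSq P g n) := by
  refine Finset.measurable_fun_sum _ fun k hk => ?_
  have := Finset.mem_range.1 hk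
  exact measurable_dyadic_mono (by omega) (measurable_condVar P g k).ennreal_toReal

theorem integral_cells_weight [IsFiniteMeasure P] {n : ℕ} {u : ℝ → ℝ}
    (hu : Measurable[dyadicFiltration n] u) {F : Finset ℤ} {w : ℤ → ℝ} (hw : ∀ j ∉ F, w j = 0) :
    ∫ x, w (dyadicIndex 0 x) * u x ∂P = ∑ j ∈ F, w j * ∫ x in cell j, u x ∂P := by
  have hi : Integrable (fun x => w (dyadicIndex 0 x) * u x) P :=
    integrable_of_vanish ((measurable_dyadic_mono (Nat.zero_le n)
      (measurable_comp_dyadicIndex 0 w)).mul hu) (F := F)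
      fun x hx => by simp [hw _ (fun h => hx (mem_cells_iff.2 h))]
  refine (hasSum_integral_dyadic 0 hi).unique ?_
  have e : ∀ k, ∫ x in dyadicInterval 0 k, w (dyadicIndex 0 x) * u x ∂P =
      w k * ∫ x in cell k, u x ∂P := by
    intro k
    rw [dyadicInterval_zero, setIntegral_congr_fun (g := fun x => w k * u x) (measurableSet_cell k)
      (fun x hx => by simp only [mem_cell_iff.1 hx]), integral_const_mul]
  simp only [e]
  exact hasSum_sum_of_ne_finset_zero fun j hj => by simp [hw j hj]

/-- The energies `∫_{A_j} S_N^{p'}` of the partial square functions. -/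
def energy (P : Measure ℝ) (r : ℝ) (g : ℕ → ℝ → ℝ) (N : ℕ) (j : ℤ) : ℝ :=
  ∫ x in cell j, partialSq P g N x ^ r ∂P

theorem energy_nonneg (r : ℝ) (g : ℕ → ℝ → ℝ) (N : ℕ) (j : ℤ) : 0 ≤ energy P r g N j :=
  integral_nonneg fun x => Real.rpow_nonneg (partialSq_nonneg g N x) r

section Test

variable [IsFiniteMeasure P] {p q p' q' : ℝ≥0∞} [Fact (1 ≤ p)] [Fact (1 ≤ q)]

theorem ofReal_energy {r : ℝ} (g : ℕ → ℝ → ℝ) (N : ℕ) (j : ℤ) :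
    ENNReal.ofReal (energy P r g N j) =
      ∫⁻ x in cell j, ENNReal.ofReal (partialSq P g N x ^ r) ∂P := by
  refine ofReal_integral_eq_lintegral_ofReal ?_
    (ae_of_all _ fun x => Real.rpow_nonneg (partialSq_nonneg g N x) r)
  exact (integrableOn_cells ((measurable_partialSq P g N).pow_const r) {j}).mono_set
    (cell_subset_cells (by simp))

/-- The hypothesis on `K` is applied to one explicit transform of `g`, the analogue of testing h ∈
L_{p'} against |h|^{p'-2} h. The first factor of the constant comes from the pairing, the second
from the norm of the test martingale. -/
theorem IsDyadicMartingale.sum_energy_le (hp : p.toReal.HolderConjugate p'.toReal)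
    (hq : q.toReal.HolderConjugate q'.toReal) {g : ℕ → ℝ → ℝ} (hg : IsDyadicMartingale P g)
    {K : ℝ} (hK0 : 0 ≤ K)
    (hK : ∀ (f : HsMartingale P p q) (N : ℕ) (F : Finset ℤ), IsFiniteMartingale f.seq N F →
      |∑ n ∈ Finset.range (N + 1), ∫ x, mdiff f.seq n x * mdiff g n x ∂P| ≤ K * ‖f‖)
    (N : ℕ) (F : Finset ℤ) :
    (∑ j ∈ F, energy P (p'.toReal / 2) g N j ^ (q'.toReal / p'.toReal)) ^ (1 / q'.toReal) ≤
      max 1 (p'.toReal / 2) * ((min 1 (p'.toReal - 1))⁻¹ ^ (1 / 2 : ℝ)) * K := by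
  obtain ⟨hp0, hpt⟩ := ENNReal.toReal_pos_iff.1 hp.pos
  obtain ⟨hq0, hqt⟩ := ENNReal.toReal_pos_iff.1 hq.pos
  set a := p.toReal
  set b := q.toReal
  set a' := p'.toReal
  set b' := q'.toReal
  have ha := hp.pos
  have ha' := hp.symm.pos
  have hb := hq.pos
  have hb' := hq.symm.pos
  have hθ : 0 < a' - 1 := by linarith [hp.symm.lt]
  set B : ℝ := (min 1 (a' - 1))⁻¹ ^ (1 / 2 : ℝ) with hB
  have hmin : 0 < min 1 (a' - 1) := lt_min one_pos hθ
  have hB0 : 0 ≤ B := by positivity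
  have hBB : B ^ 2 = (min 1 (a' - 1))⁻¹ := by
    rw [hB, ← Real.rpow_natCast, ← Real.rpow_mul (by positivity)]; norm_num
  set r := a' / 2 with hr
  have hr0 : 0 < r := by positivity
  set E := energy P r g N with hE
  have hE0 : ∀ j, 0 ≤ E j := energy_nonneg r g N
  set S := partialSq P g with hSdef
  have hS0 : ∀ n x, 0 ≤ S n x := partialSq_nonneg g
  have hSm : ∀ n, Measurable[dyadicFiltration (n - 1)] (S n) := measurable_partialSq P g
  -- The exponent is the ℓ_q duality choice: on `F` both `w j * E j` and `w j ^ b * E j ^ (b / a)`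
  -- equal `E j ^ (b' / a')`.
  set w : ℤ → ℝ := fun j => if j ∈ F then E j ^ (b' / a' - 1) else 0 with hw
  have hw0 : ∀ j, 0 ≤ w j := fun j => by
    simp only [hw]; split_ifs
    · exact Real.rpow_nonneg (hE0 j) _
    · exact le_rfl
  have hwF : ∀ j ∉ F, w j = 0 := fun j hj => by simp [hw, hj]
  have hwm : ∀ n, Measurable[dyadicFiltration n] fun x => w (dyadicIndex 0 x) := fun n =>
    measurable_dyadic_mono (Nat.zero_le n) (measurable_comp_dyadicIndex 0 w)
  -- Where S_n = 0 the value of a power with exponent `r - 1 ≤ 0` is immaterial, as almost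
  -- everywhere the conditional variance at time `n` vanishes there too.
  set V : ℕ → ℝ → ℝ := fun n x => if n ≤ N then w (dyadicIndex 0 x) * S n x ^ (r - 1) else 0
    with hV
  have hVm : ∀ n, Measurable[dyadicFiltration (n - 1)] (V n) := by
    intro n
    by_cases hn : n ≤ N
    · simp only [hV, hn, if_true]
      exact (hwm _).mul ((hSm n).pow_const _)
    · simp only [hV, hn, if_false]
      exact @measurable_const _ _ _ (dyadicFiltration (n - 1)) _
  have hV0 : ∀ n x, 0 ≤ V n x := by
    intro n x
    simp only [hV]; split_ifs
    · exact mul_nonneg (hw0 _) (Real.rpow_nonneg (hS0 n x) _)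
    · exact le_rfl
  have hVF : ∀ n, ∀ x ∉ cells F, V n x = 0 := by
    intro n x hx
    simp [hV, hwF _ (fun h => hx (mem_cells_iff.2 h))]
  have hVN : ∀ n, N < n → V n = 0 := by
    intro n hn
    ext x
    simp [hV, not_le.2 hn]
  have hfin := isFiniteMartingale_transform (f := g) hVN hVF
  have hfM := hg.transform hVm
  let f : HsMartingale P p q := ⟨DyadicHardy.transform V g, hfM.mem_of_finite hpt.ne hqt.ne hfin⟩
  have hfseq : f.seq = DyadicHardy.transform V g := rfl
  set T := ∑ j ∈ F, E j ^ (b' / a') with hT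
  have hT0 : 0 ≤ T := Finset.sum_nonneg fun j _ => Real.rpow_nonneg (hE0 j) _
  -- the pairing of the test martingale with `g`
  have hpair : T ≤ max 1 r * ∑ n ∈ Finset.range (N + 1), ∫ x, mdiff f.seq n x * mdiff g n x ∂P := by
    have e1 : ∀ n ∈ Finset.range (N + 1), ∫ x, mdiff f.seq n x * mdiff g n x ∂P =
        ∫ x, V n x * (condVar P g n x).toReal ∂P := by
      intro n _
      rw [hg.integral_mul_condVar (hVm n) (hV0 n), hfseq, mdiff_transform]
      refine integral_congr_ae (ae_of_all _ fun x => ?_)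
      simp only [Pi.mul_apply]; ring
    have i1 : ∀ n, Integrable (fun x => V n x * (condVar P g n x).toReal) P := fun n =>
      integrable_of_vanish (n := n - 1) ((hVm n).mul (measurable_condVar P g n).ennreal_toReal)
        (F := F) fun x hx => by simp [hVF n x hx]
    have hSr : Measurable[dyadicFiltration (N - 1)] fun x => S N x ^ r := (hSm N).pow_const r
    have i2 : Integrable (fun x => w (dyadicIndex 0 x) * S N x ^ r) P :=
      integrable_of_vanish ((hwm _).mul hSr) (F := F)
        fun x hx => by simp [hwF _ (fun h => hx (mem_cells_iff.2 h))]
    have e2 : T = ∫ x, w (dyadicIndex 0 x) * S N x ^ r ∂P := by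
      rw [integral_cells_weight hSr hwF]
      refine Finset.sum_congr rfl fun j hj => ?_
      have : w j = E j ^ (b' / a' - 1) := by simp [hw, hj]
      rw [this]
      change _ = _ * E j
      -- The exponent `b' / a' - 1` may be negative, so zero energy is treated apart; both sides
      -- then vanish.
      rcases (hE0 j).eq_or_lt with h | h
      · rw [← h, Real.zero_rpow (by positivity), mul_zero]
      · rw [Real.rpow_sub_one h.ne', div_mul_cancel₀ _ h.ne']
    rw [Finset.sum_congr rfl e1, ← integral_finsetSum _ fun n _ => i1 n, e2, ← integral_const_mul]
    refine integral_mono i2 ((integrable_finsetSum _ fun n _ => i1 n).const_mul _) fun x => ?_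
    -- The upper power-sum bound with θ = p'/2 gives the factor `max 1 r`.
    have h := (partial_sum_rpow_bounds (a := fun n => (condVar P g n x).toReal)
      (fun n => ENNReal.toReal_nonneg) hr0 N).2
    have h' := mul_le_mul_of_nonneg_left h (hw0 (dyadicIndex 0 x))
    refine h'.trans (le_of_eq ?_)
    rw [← mul_assoc, mul_comm _ (max 1 r), mul_assoc, Finset.mul_sum]
    congr 1
    refine Finset.sum_congr rfl fun n hn => ?_
    have hn' : n ≤ N := Nat.lt_succ_iff.1 (Finset.mem_range.1 hn)
    simp only [hV, hn', if_true, hSdef, partialSq]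
    ring
  -- the norm of the test martingale
  have hcond : ∀ᵐ x ∂P, condSq P f.seq x ≤
      ENNReal.ofReal (w (dyadicIndex 0 x) * B * S N x ^ ((a' - 1) / 2)) := by
    filter_upwards [hg.condVar_transform hVm, hg.condVar_ne_top] with x hx hxt
    have h1 : ∑' n, condVar P f.seq n x = ENNReal.ofReal
        (∑ n ∈ Finset.range (N + 1), V n x ^ 2 * (condVar P g n x).toReal) := by
      rw [ENNReal.ofReal_sum_of_nonneg fun n _ => by positivity, tsum_eq_sum
        (s := Finset.range (N + 1))]
      · refine Finset.sum_congr rfl fun n _ => ?_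
        rw [hfseq, hx, ENNReal.ofReal_mul (by positivity), ENNReal.ofReal_toReal (hxt n),
          ENNReal.ofReal_pow (hV0 n x), ← Real.enorm_eq_ofReal (hV0 n x)]
      · intro n hn
        rw [hfseq, hx, hVN n (by simpa using hn)]
        simp
    have h2 : ∑ n ∈ Finset.range (N + 1), V n x ^ 2 * (condVar P g n x).toReal ≤
        (w (dyadicIndex 0 x) * B * S N x ^ ((a' - 1) / 2)) ^ 2 := by
      -- Squaring the weight produces S_n^{p'-2}, so here the lower power-sum bound is used with θ =
      -- p' - 1; this is the origin of `B`.
      have h := (partial_sum_rpow_bounds (a := fun n => (condVar P g n x).toReal)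
        (fun n => ENNReal.toReal_nonneg) hθ N).1
      rw [← le_div_iff₀' hmin] at h
      rw [mul_pow, mul_pow, hBB, ← Real.rpow_natCast (S N x ^ _), ← Real.rpow_mul (hS0 N x)]
      have e3 : (a' - 1) / 2 * ((2 : ℕ) : ℝ) = a' - 1 := by push_cast; ring
      rw [e3]
      calc ∑ n ∈ Finset.range (N + 1), V n x ^ 2 * (condVar P g n x).toReal
          = w (dyadicIndex 0 x) ^ 2 * ∑ n ∈ Finset.range (N + 1), (condVar P g n x).toReal *
            (∑ k ∈ Finset.range (n + 1), (condVar P g k x).toReal) ^ (a' - 1 - 1) := by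
            rw [Finset.mul_sum]
            refine Finset.sum_congr rfl fun n hn => ?_
            have hn' : n ≤ N := Nat.lt_succ_iff.1 (Finset.mem_range.1 hn)
            have e4 : (S n x ^ (r - 1)) ^ 2 = S n x ^ (a' - 1 - 1) := by
              rw [← Real.rpow_natCast, ← Real.rpow_mul (hS0 n x)]
              congr 1
              push_cast; rw [hr]; ring
            simp only [hV, hn', if_true]
            rw [mul_pow, e4]
            simp only [hSdef, partialSq]
            ring
        _ ≤ w (dyadicIndex 0 x) ^ 2 * ((∑ k ∈ Finset.range (N + 1),
              (condVar P g k x).toReal) ^ (a' - 1) / min 1 (a' - 1)) := by gcongr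
        _ = _ := by rw [div_eq_inv_mul, ← mul_assoc]; rfl
    have h3 : 0 ≤ w (dyadicIndex 0 x) * B * S N x ^ ((a' - 1) / 2) :=
      mul_nonneg (mul_nonneg (hw0 _) hB0) (Real.rpow_nonneg (hS0 N x) _)
    rw [condSq_eq, h1]
    calc ENNReal.ofReal _ ^ (1 / 2 : ℝ)
        ≤ ENNReal.ofReal ((w (dyadicIndex 0 x) * B * S N x ^ ((a' - 1) / 2)) ^ 2) ^ (1 / 2 : ℝ) := by
          gcongr
      _ = _ := by
        rw [ENNReal.ofReal_rpow_of_nonneg (by positivity) (by norm_num), ← Real.rpow_natCast,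
          ← Real.rpow_mul h3]
        norm_num
  have hnorm : ‖f‖ ≤ B * T ^ (1 / b) := by
    have hBT : 0 ≤ B * T ^ (1 / b) := by positivity
    refine ENNReal.toReal_le_of_le_ofReal hBT ?_
    refine (amalgamNorm_mono hcond).trans ?_
    rw [amalgamNorm_eq hp0.ne' hpt.ne hq0.ne' hqt.ne]
    have hcell : ∀ j, (∫⁻ x in cell j, ENNReal.ofReal (w (dyadicIndex 0 x) * B *
        S N x ^ ((a' - 1) / 2)) ^ a ∂P) ^ (b / a) =
        ENNReal.ofReal (B ^ b * ((w j) ^ b * E j ^ (b / a))) := by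
      intro j
      have h1 : ∫⁻ x in cell j, ENNReal.ofReal (w (dyadicIndex 0 x) * B *
          S N x ^ ((a' - 1) / 2)) ^ a ∂P = ENNReal.ofReal ((w j * B) ^ a * E j) := by
        have hc : 0 ≤ w j * B := mul_nonneg (hw0 j) hB0
        rw [ENNReal.ofReal_mul (by positivity), hE, ofReal_energy, ← lintegral_const_mul' _ _
          ENNReal.ofReal_ne_top]
        refine setLIntegral_congr_fun (measurableSet_cell j) fun x hx => ?_
        rw [mem_cell_iff.1 hx, ENNReal.ofReal_rpow_of_nonneg
          (mul_nonneg hc (Real.rpow_nonneg (hS0 N x) _)) ha.le, Real.mul_rpow hc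
          (Real.rpow_nonneg (hS0 N x) _), ENNReal.ofReal_mul (by positivity),
          ← Real.rpow_mul (hS0 N x)]
        -- Conjugacy, (p' - 1)p = p', turns the p-th power of the bound for s(f) back into the
        -- integrand of the energy.
        have e5 : (a' - 1) / 2 * a = r := by
          have := hp.symm.sub_one_mul_conj
          rw [hr]; linarith
        rw [e5]
      rw [h1, ENNReal.ofReal_rpow_of_nonneg
        (mul_nonneg (Real.rpow_nonneg (mul_nonneg (hw0 j) hB0) _) (hE0 j)) (by positivity)]
      congr 1
      rw [Real.mul_rpow (Real.rpow_nonneg (mul_nonneg (hw0 j) hB0) _) (hE0 j),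
        ← Real.rpow_mul (mul_nonneg (hw0 j) hB0), mul_div_cancel₀ _ ha.ne',
        Real.mul_rpow (hw0 j) hB0]
      ring
    have hsum : ∑' j, (∫⁻ x in cell j, ENNReal.ofReal (w (dyadicIndex 0 x) * B *
        S N x ^ ((a' - 1) / 2)) ^ a ∂P) ^ (b / a) = ENNReal.ofReal (B ^ b * T) := by
      simp only [hcell]
      rw [tsum_eq_sum (s := F) (fun j hj => by simp [hwF j hj, Real.zero_rpow hb.ne']), hT,
        Finset.mul_sum, ENNReal.ofReal_sum_of_nonneg fun j _ =>
          mul_nonneg (by positivity) (Real.rpow_nonneg (hE0 j) _)]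
      refine Finset.sum_congr rfl fun j hj => ?_
      have hwj : w j = E j ^ (b' / a' - 1) := by simp [hw, hj]
      congr 2
      rcases (hE0 j).eq_or_lt with h | h
      · rw [← h, Real.zero_rpow (by positivity), Real.zero_rpow (by positivity), mul_zero]
      · rw [hwj, ← Real.rpow_mul h.le, ← Real.rpow_add h]
        congr 1
        have h1 := hp.inv_add_inv_eq_one
        have h2 := hq.symm.sub_one_mul_conj
        have h3 : b / a = b * (1 - a'⁻¹) := by rw [← h1]; field_simp; ring
        rw [h3]
        have h4 : (b' / a' - 1) * b + b * (1 - a'⁻¹) = ((b' - 1) * b) / a' := by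
          field_simp; ring
        rw [h4, h2]
    rw [hsum, ENNReal.ofReal_rpow_of_nonneg (by positivity) (by positivity)]
    refine le_of_eq ?_
    congr 1
    rw [Real.mul_rpow (by positivity) hT0, ← Real.rpow_mul hB0, mul_one_div_cancel hb.ne',
      Real.rpow_one]
  -- conclusion
  have hfinal : T ≤ max 1 r * B * K * T ^ (1 / b) := by
    have h1 := (le_abs_self _).trans (hK f N F hfin)
    have h2 : 0 < max 1 r := lt_max_of_lt_left one_pos
    calc T ≤ max 1 r * (K * ‖f‖) := hpair.trans (by gcongr)
      _ ≤ max 1 r * (K * (B * T ^ (1 / b))) := by gcongr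
      _ = _ := by ring
  -- For T > 0 the factor T^{1/q} cancels from T = T^{1/q'} T^{1/q}. Finiteness of T, needed for
  -- this, is the reason for truncating to `N` and `F`.
  rcases hT0.eq_or_lt with h | h
  · rw [← h, Real.zero_rpow (by positivity)]
    have : 0 < max 1 r := lt_max_of_lt_left one_pos
    positivity
  · have h1 : T = T ^ (1 / b') * T ^ (1 / b) := by
      rw [← Real.rpow_add h, one_div, one_div, hq.symm.inv_add_inv_eq_one, Real.rpow_one]
    have h2 : 0 < T ^ (1 / b) := by positivity
    refine le_of_mul_le_mul_right ?_ h2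
    rw [← h1]
    exact hfinal

theorem IsDyadicMartingale.tendsto_partialSq {g : ℕ → ℝ → ℝ} (hg : IsDyadicMartingale P g)
    {s : ℝ} (hs : 0 < s) : ∀ᵐ x ∂P, Tendsto
      (fun N => ENNReal.ofReal (partialSq P g N x ^ (s / 2))) atTop (nhds (condSq P g x ^ s)) := by
  filter_upwards [hg.condVar_ne_top] with x hx
  have e : ∀ N, ENNReal.ofReal (partialSq P g N x ^ (s / 2)) =
      (∑ k ∈ Finset.range (N + 1), condVar P g k x) ^ (s / 2) := by
    intro N
    rw [← ENNReal.ofReal_rpow_of_nonneg (partialSq_nonneg g N x) (by positivity), partialSq,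
      ← ENNReal.toReal_sum fun k _ => hx k,
      ENNReal.ofReal_toReal (ENNReal.sum_ne_top.2 fun k _ => hx k)]
  have h1 : condSq P g x ^ s = (∑' k, condVar P g k x) ^ (s / 2) := by
    rw [condSq_eq, ← ENNReal.rpow_mul]; congr 1; ring
  rw [h1]
  simp only [e]
  exact ((ENNReal.continuous_rpow_const.tendsto _).comp
    ((ENNReal.tendsto_nat_tsum _).comp (tendsto_add_atTop_nat 1)))

/-- A dyadic martingale that acts boundedly on finite martingales belongs to `H^s_{p',q'}`. -/
theorem IsDyadicMartingale.amalgamNorm_le (hp : p.toReal.HolderConjugate p'.toReal)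
    (hq : q.toReal.HolderConjugate q'.toReal) {g : ℕ → ℝ → ℝ} (hg : IsDyadicMartingale P g)
    {K : ℝ} (hK0 : 0 ≤ K)
    (hK : ∀ (f : HsMartingale P p q) (N : ℕ) (F : Finset ℤ), IsFiniteMartingale f.seq N F →
      |∑ n ∈ Finset.range (N + 1), ∫ x, mdiff f.seq n x * mdiff g n x ∂P| ≤ K * ‖f‖) :
    amalgamNorm P p' q' (condSq P g) ≤ ENNReal.ofReal
      (max 1 (p'.toReal / 2) * ((min 1 (p'.toReal - 1))⁻¹ ^ (1 / 2 : ℝ)) * K) := by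
  obtain ⟨hp0, hpt⟩ := ENNReal.toReal_pos_iff.1 hp.symm.pos
  obtain ⟨hq0, hqt⟩ := ENNReal.toReal_pos_iff.1 hq.symm.pos
  have ha' := hp.symm.pos
  have hb' := hq.symm.pos
  have hmin : 0 < min 1 (p'.toReal - 1) := lt_min one_pos (by linarith [hp.symm.lt])
  have hmax : 0 < max 1 (p'.toReal / 2) := lt_max_of_lt_left one_pos
  rw [amalgamNorm_eq hp0.ne' hpt.ne hq0.ne' hqt.ne, one_div, ENNReal.rpow_inv_le_iff hb',
    ENNReal.ofReal_rpow_of_nonneg (by positivity) hb'.le]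
  -- The bound is uniform in `N` and `F`: finite sets of cells exhaust the series, and N → ∞ is
  -- monotone convergence on each cell.
  refine ENNReal.summable.tsum_le_of_sum_le fun F => ?_
  have hlim : Tendsto (fun N => ∑ j ∈ F, ENNReal.ofReal
      (energy P (p'.toReal / 2) g N j) ^ (q'.toReal / p'.toReal)) atTop
      (nhds (∑ j ∈ F, (∫⁻ x in cell j, condSq P g x ^ p'.toReal ∂P) ^
        (q'.toReal / p'.toReal))) := by
    refine tendsto_finsetSum _ fun j _ => (ENNReal.continuous_rpow_const.tendsto _).comp ?_
    simp only [ofReal_energy]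
    refine lintegral_tendsto_of_tendsto_of_monotone (fun N => ?_) (ae_of_all _ fun x => ?_)
      (ae_restrict_of_ae (hg.tendsto_partialSq ha'))
    · have := measurable_of_dyadic (measurable_partialSq P g N)
      fun_prop
    · intro N M hNM
      refine ENNReal.ofReal_le_ofReal (Real.rpow_le_rpow (partialSq_nonneg g N x) ?_ (by positivity))
      exact Finset.sum_le_sum_of_subset_of_nonneg (Finset.range_mono (by omega))
        fun _ _ _ => ENNReal.toReal_nonneg
  refine le_of_tendsto' hlim fun N => ?_
  have h := hg.sum_energy_le hp hq hK0 hK N F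
  have h0 : ∀ j, 0 ≤ energy P (p'.toReal / 2) g N j := energy_nonneg _ g N
  rw [Finset.sum_congr rfl fun j _ => ENNReal.ofReal_rpow_of_nonneg (h0 j) (by positivity),
    ← ENNReal.ofReal_sum_of_nonneg fun j _ => Real.rpow_nonneg (h0 j) _]
  refine ENNReal.ofReal_le_ofReal ?_
  rwa [one_div, Real.rpow_inv_le_iff_of_pos
    (Finset.sum_nonneg fun j _ => Real.rpow_nonneg (h0 j) _) (by positivity) hb'] at h

end Test

/-! ### Martingales from additive functions of dyadic intervals -/

/-- The density of `c` with respect to `P` at generation `n`; it vanishes on null intervals. -/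
def density (P : Measure ℝ) (n : ℕ) (c : ℤ → ℝ) (x : ℝ) : ℝ :=
  c (dyadicIndex n x) / P.real (dyadicInterval n (dyadicIndex n x))

theorem measurable_density (P : Measure ℝ) (n : ℕ) (c : ℤ → ℝ) :
    Measurable[dyadicFiltration n] (density P n c) :=
  measurable_comp_dyadicIndex n fun k => c k / P.real (dyadicInterval n k)

theorem setIntegral_comp_dyadicIndex {n : ℕ} {u : ℝ → ℝ} (hu : Measurable[dyadicFiltration n] u)
    (x : ℝ) : ∫ y in dyadicInterval n (dyadicIndex n x), u y ∂P =
      u x * P.real (dyadicInterval n (dyadicIndex n x)) := by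
  obtain ⟨c, hc⟩ := exists_eq_comp_dyadicIndex hu
  rw [setIntegral_congr_fun (g := fun _ => u x) (measurableSet_dyadicInterval' n _)
    (fun y hy => by simp only [hc, dyadicIndex_eq_iff.2 hy]), setIntegral_const, smul_eq_mul,
    mul_comm]

theorem dyadicInterval_nonempty (n : ℕ) (k : ℤ) : ∃ x, dyadicIndex n x = k :=
  ⟨k / 2 ^ n, by rw [dyadicIndex, div_mul_cancel₀ _ (by positivity), Int.floor_intCast]⟩

/-- `c` is additive on dyadic intervals and vanishes on null ones. -/
structure IsDyadicMass (P : Measure ℝ) (c : ℕ → ℤ → ℝ) : Prop where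
  add : ∀ n k, c n k = c (n + 1) (2 * k) + c (n + 1) (2 * k + 1)
  null : ∀ n k, P (dyadicInterval n k) = 0 → c n k = 0

theorem IsDyadicMass.setIntegral_density [IsFiniteMeasure P] {c : ℕ → ℤ → ℝ}
    (hc : IsDyadicMass P c) (n : ℕ) (k : ℤ) :
    ∫ x in dyadicInterval n k, density P n (c n) x ∂P = c n k := by
  obtain ⟨x, rfl⟩ := dyadicInterval_nonempty n k
  rw [setIntegral_comp_dyadicIndex (measurable_density P n (c n)), density]
  -- On a null interval the quotient does not recover `c`; the vanishing of `c` there does.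
  by_cases h : P (dyadicInterval n (dyadicIndex n x)) = 0
  · rw [hc.null _ _ h]; simp
  · exact div_mul_cancel₀ _ ((measureReal_eq_zero_iff).not.2 h)

theorem disjoint_children (n : ℕ) (k : ℤ) :
    Disjoint (dyadicInterval (n + 1) (2 * k)) (dyadicInterval (n + 1) (2 * k + 1)) :=
  pairwise_disjoint_dyadicInterval (n + 1) (by omega)

theorem IsDyadicMass.setIntegral_density_succ [IsFiniteMeasure P] {c : ℕ → ℤ → ℝ}
    (hc : IsDyadicMass P c) (n : ℕ) (k : ℤ) :
    ∫ x in dyadicInterval n k, density P (n + 1) (c (n + 1)) x ∂P = c n k := by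
  rw [dyadicInterval_eq_union, setIntegral_union (disjoint_children n k)
    (measurableSet_dyadicInterval' _ _) (integrableOn_dyadicInterval (measurable_density P _ _) _ _)
    (integrableOn_dyadicInterval (measurable_density P _ _) _ _), hc.setIntegral_density,
    hc.setIntegral_density, ← hc.add]

/-- The martingale of densities of `c`, started at zero. -/
def massMartingale (P : Measure ℝ) (c : ℕ → ℤ → ℝ) (n : ℕ) : ℝ → ℝ :=
  density P n (c n) - density P 0 (c 0)

theorem IsDyadicMass.isDyadicMartingale [IsFiniteMeasure P] {c : ℕ → ℤ → ℝ}
    (hc : IsDyadicMass P c) : IsDyadicMartingale P (massMartingale P c) := by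
  have hd := measurable_density P
  refine isDyadicMartingale_of_setIntegral (by simp [massMartingale]) (fun n => ?_) fun n k => ?_
  · exact (hd n _).sub (measurable_dyadic_mono (Nat.zero_le n) (hd 0 _))
  · simp only [massMartingale, Pi.sub_apply]
    rw [integral_sub (integrableOn_dyadicInterval (hd _ _) _ _)
      (integrableOn_dyadicInterval (hd _ _) _ _), integral_sub
      (integrableOn_dyadicInterval (hd _ _) _ _) (integrableOn_dyadicInterval (hd _ _) _ _),
      hc.setIntegral_density, hc.setIntegral_density_succ]

/-- The function `I ↦ ∫_I u` of dyadic intervals. -/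
def integralMass (P : Measure ℝ) (u : ℝ → ℝ) (n : ℕ) (k : ℤ) : ℝ :=
  ∫ x in dyadicInterval n k, u x ∂P

theorem isDyadicMass_integralMass {u : ℝ → ℝ} (hu : Integrable u P) :
    IsDyadicMass P (integralMass P u) where
  add n k := by
    simp only [integralMass]
    rw [dyadicInterval_eq_union, setIntegral_union (disjoint_children n k)
      (measurableSet_dyadicInterval' _ _) hu.integrableOn hu.integrableOn]
  null n k h := setIntegral_measure_zero _ h

/-- Here `v` is E_n u, recovered as an average over intervals, at every point whose interval is not
null. -/
theorem density_integralMass [IsFiniteMeasure P] {n : ℕ} {u v : ℝ → ℝ}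
    (hv : Measurable[dyadicFiltration n] v)
    (huv : ∀ k, ∫ x in dyadicInterval n k, u x ∂P = ∫ x in dyadicInterval n k, v x ∂P) {x : ℝ}
    (hx : P (dyadicInterval n (dyadicIndex n x)) ≠ 0) :
    density P n (integralMass P u n) x = v x := by
  rw [density, integralMass, huv, setIntegral_comp_dyadicIndex hv,
    mul_div_cancel_right₀ _ ((measureReal_eq_zero_iff).not.2 hx)]

/-! ### Representation of functionals on finite martingales -/

section Finite

variable {p q : ℝ≥0∞} [Fact (1 ≤ p)] [Fact (1 ≤ q)]

theorem HsMartingale.norm_sub_eq_zero {f g : HsMartingale P p q}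
    (h : ∀ n, f.seq n =ᵐ[P] g.seq n) : ‖f - g‖ = 0 := by
  have h1 : condSq P (f - g).seq =ᵐ[P] condSq P 0 := condSq_congr fun n => by
    filter_upwards [h n] with x hx
    exact sub_eq_zero.2 hx
  have h2 := (amalgamNorm_mono (p := p) (q := q) (h1.mono fun x hx => hx.le)).trans
    (amalgamNorm_condSq_zero P p q).le
  rw [HsMartingale.norm_def, le_zero_iff.1 h2, ENNReal.toReal_zero]

/-- Densities are set to zero on null intervals, so the identities between martingales below hold
only almost surely; a continuous functional does not see the difference. -/
theorem apply_eq_of_ae (κ : HsMartingale P p q →L[ℝ] ℝ) {f g : HsMartingale P p q}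
    (h : ∀ n, f.seq n =ᵐ[P] g.seq n) : κ f = κ g := by
  have := κ.le_opNorm (f - g)
  rw [HsMartingale.norm_sub_eq_zero h, mul_zero, map_sub, norm_le_zero_iff, sub_eq_zero] at this
  exact this

theorem HsMartingale.sum_smul_seq {ι : Type*} (s : Finset ι) (c : ι → ℝ) (f : ι → HsMartingale P p q)
    (n : ℕ) (x : ℝ) : (∑ i ∈ s, c i • f i).seq n x = ∑ i ∈ s, c i * (f i).seq n x := by
  classical
  induction s using Finset.induction_on with
  | empty => rfl
  | insert i s hi ih => rw [Finset.sum_insert hi, Finset.sum_insert hi, ← ih]; rfl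

variable [IsFiniteMeasure P]

/-- Stopping at time `N` by a predictable 0-1 transform changes `f` on a null set only and gives a
genuinely finite martingale. -/
theorem IsDyadicMartingale.mem_of_ae_eventually_const (hp' : p ≠ ∞) (hq' : q ≠ ∞) {f : ℕ → ℝ → ℝ}
    (hf : IsDyadicMartingale P f) {N : ℕ} {F : Finset ℤ} (hN : ∀ n, N ≤ n → f n =ᵐ[P] f N)
    (hF : ∀ n, ∀ x ∉ cells F, f n x = 0) : f ∈ hsSubmodule P p q := by
  have hv : ∀ n : ℕ, Measurable[dyadicFiltration (n - 1)]
      (if n ≤ N then (cells F).indicator (1 : ℝ → ℝ) else 0) := by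
    intro n
    split_ifs
    · exact measurable_dyadic_indicator_one (measurableSet_cells _ F)
    · exact @measurable_const _ _ _ (dyadicFiltration (n - 1)) (0 : ℝ)
  have h1 := hf.transform hv
  have h2 : DyadicHardy.transform _ f ∈ hsSubmodule P p q := h1.mem_of_finite hp' hq'
    (isFiniteMartingale_transform (N := N) (F := F) (fun n hn => by simp [not_le.2 hn])
      (fun n x hx => by split_ifs <;> simp [hx]))
  refine ⟨hf, lt_of_le_of_lt (amalgamNorm_mono ?_) h2.2⟩
  have h3 : ∀ᵐ x ∂P, ∀ n, N < n → mdiff f n x = 0 := by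
    rw [ae_all_iff]
    intro n
    by_cases hn : N < n
    · filter_upwards [hN n hn.le, hN (n - 1) (by omega)] with x h1 h2 _
      simp [mdiff, h1, h2]
    · simp [hn]
  refine (condSq_congr fun n => ?_).mono fun x hx => le_of_eq hx
  filter_upwards [h3] with x hx
  rw [← congrFun (hf.sum_mdiff n) x, DyadicHardy.transform, Finset.sum_apply, Finset.sum_apply]
  refine Finset.sum_congr rfl fun k _ => ?_
  by_cases hxF : x ∈ cells F
  · by_cases hk : k ≤ N
    · simp [hk, hxF]
    · simp [hk, hx k (not_le.1 hk)]
  · simp [mdiff, hF _ x hxF]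

/-- The indicator function of a dyadic interval. -/
def dyadicIndicator (N : ℕ) (k : ℤ) : ℝ → ℝ := (dyadicInterval N k).indicator 1

theorem measurable_dyadicIndicator (N : ℕ) (k : ℤ) :
    Measurable[dyadicFiltration N] (dyadicIndicator N k) :=
  measurable_dyadic_indicator_one (measurableSet_dyadicInterval N k)

theorem integrable_dyadicIndicator (N : ℕ) (k : ℤ) : Integrable (dyadicIndicator N k) P :=
  integrable_of_vanish (measurable_dyadicIndicator N k) (F := {k / 2 ^ N}) fun _ hx =>
    indicator_of_notMem (fun h => hx (cell_subset_cells (by simp)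
      (dyadicInterval_subset_cell N k h))) _

theorem massMartingale_dyadicIndicator_mem (hp' : p ≠ ∞) (hq' : q ≠ ∞) (N : ℕ) (k : ℤ) :
    massMartingale P (integralMass P (dyadicIndicator N k)) ∈ hsSubmodule P p q := by
  have hm := (isDyadicMass_integralMass (integrable_dyadicIndicator (P := P) N k)).isDyadicMartingale
  refine hm.mem_of_ae_eventually_const hp' hq' (N := N) (F := {k / 2 ^ N}) (fun n hn => ?_)
    fun n x hx => ?_
  -- From generation `N` on the indicator is measurable, so off null intervals its density is the
  -- indicator itself.
  · filter_upwards [ae_measure_dyadicInterval_ne_zero P] with x hx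
    simp only [massMartingale, Pi.sub_apply]
    rw [density_integralMass (measurable_dyadicIndicator N k) (fun _ => rfl) (hx N),
      density_integralMass (measurable_dyadic_mono hn (measurable_dyadicIndicator N k))
        (fun _ => rfl) (hx n)]
  · have key : ∀ m, density P m (integralMass P (dyadicIndicator N k) m) x = 0 := by
      intro m
      rw [density, integralMass, setIntegral_congr_fun (g := fun _ => 0)
        (measurableSet_dyadicInterval' m _) (fun y hy => ?_), integral_zero, zero_div]
      refine indicator_of_notMem (fun h => hx ?_) _
      rw [mem_cells_iff, dyadicIndex_zero_eq m, ← dyadicIndex_eq_iff.2 hy, ← dyadicIndex_zero_eq,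
        mem_cell_iff.1 (dyadicInterval_subset_cell N k h)]
      simp
    simp [massMartingale, key]

/-- The element of `H^s_{p,q}` generated by the indicator function of a dyadic interval. -/
def indicatorMartingale (P : Measure ℝ) [IsFiniteMeasure P] (hp' : p ≠ ∞) (hq' : q ≠ ∞) (N : ℕ)
    (k : ℤ) : HsMartingale P p q :=
  ⟨_, massMartingale_dyadicIndicator_mem hp' hq' N k⟩

theorem indicatorMartingale_seq (hp' : p ≠ ∞) (hq' : q ≠ ∞) (N : ℕ) (k : ℤ) :
    (indicatorMartingale P hp' hq' N k : HsMartingale P p q).seq =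
      massMartingale P (integralMass P (dyadicIndicator N k)) := rfl

theorem isDyadicMass_functional (hp' : p ≠ ∞) (hq' : q ≠ ∞) (κ : HsMartingale P p q →L[ℝ] ℝ) :
    IsDyadicMass P fun n k => κ (indicatorMartingale P hp' hq' n k) where
  add n k := by
    rw [← map_add]
    refine apply_eq_of_ae κ fun m => ae_of_all _ fun x => ?_
    change massMartingale P (integralMass P (dyadicIndicator n k)) m x =
      massMartingale P (integralMass P (dyadicIndicator (n + 1) (2 * k))) m x +
      massMartingale P (integralMass P (dyadicIndicator (n + 1) (2 * k + 1))) m x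
    have e : ∀ m l, integralMass P (dyadicIndicator n k) m l =
        integralMass P (dyadicIndicator (n + 1) (2 * k)) m l +
        integralMass P (dyadicIndicator (n + 1) (2 * k + 1)) m l := by
      intro m l
      simp only [integralMass]
      rw [← integral_add (integrable_dyadicIndicator _ _).integrableOn
        (integrable_dyadicIndicator _ _).integrableOn]
      congr 1 with y
      rw [dyadicIndicator, dyadicInterval_eq_union,
        indicator_union_of_disjoint (disjoint_children n k)]
      rfl
    simp only [massMartingale, Pi.sub_apply, density, e]
    ring
  null n k h := by
    rw [← map_zero κ]
    refine apply_eq_of_ae κ fun m => ae_of_all _ fun x => ?_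
    change massMartingale P (integralMass P (dyadicIndicator n k)) m x = 0
    have e : ∀ m l, integralMass P (dyadicIndicator n k) m l = 0 := by
      intro m l
      refine integral_eq_zero_of_ae (ae_restrict_of_ae ?_)
      exact indicator_meas_zero h
    simp [massMartingale, density, e]

/-- The indicator of a cell is measurable at generation 0, so its martingale started at zero
vanishes almost surely. Hence `riesz` is the plain density of κ: the subtracted initial term is
zero. -/
theorem functional_indicator_zero (hp' : p ≠ ∞) (hq' : q ≠ ∞) (κ : HsMartingale P p q →L[ℝ] ℝ)
    (k : ℤ) : κ (indicatorMartingale P hp' hq' 0 k) = 0 := by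
  rw [← map_zero κ]
  refine apply_eq_of_ae κ fun m => ?_
  filter_upwards [ae_measure_dyadicInterval_ne_zero P] with x hx
  change massMartingale P (integralMass P (dyadicIndicator 0 k)) m x = 0
  simp only [massMartingale, Pi.sub_apply]
  rw [density_integralMass (measurable_dyadicIndicator 0 k) (fun _ => rfl) (hx 0),
    density_integralMass (measurable_dyadic_mono (Nat.zero_le m) (measurable_dyadicIndicator 0 k))
      (fun _ => rfl) (hx m), sub_self]

/-- The martingale that represents a functional on finite martingales. -/
def riesz (hp' : p ≠ ∞) (hq' : q ≠ ∞) (κ : HsMartingale P p q →L[ℝ] ℝ) : ℕ → ℝ → ℝ :=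
  massMartingale P fun n k => κ (indicatorMartingale P hp' hq' n k)

theorem isDyadicMartingale_riesz (hp' : p ≠ ∞) (hq' : q ≠ ∞) (κ : HsMartingale P p q →L[ℝ] ℝ) :
    IsDyadicMartingale P (riesz hp' hq' κ) :=
  (isDyadicMass_functional hp' hq' κ).isDyadicMartingale

theorem setIntegral_riesz (hp' : p ≠ ∞) (hq' : q ≠ ∞) (κ : HsMartingale P p q →L[ℝ] ℝ)
    (n : ℕ) (k : ℤ) : ∫ x in dyadicInterval n k, riesz hp' hq' κ n x ∂P =
      κ (indicatorMartingale P hp' hq' n k) := by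
  rw [← (isDyadicMass_functional hp' hq' κ).setIntegral_density n k]
  congr 1 with x
  simp [riesz, massMartingale, density, functional_indicator_zero]

/-- On finite martingales the functional is given by the pairing with `riesz`. -/
theorem functional_eq_sum (hp' : p ≠ ∞) (hq' : q ≠ ∞) (κ : HsMartingale P p q →L[ℝ] ℝ)
    (f : HsMartingale P p q) {N : ℕ} {F : Finset ℤ} (hf : IsFiniteMartingale f.seq N F) :
    κ f = ∑ n ∈ Finset.range (N + 1), ∫ x, mdiff f.seq n x * mdiff (riesz hp' hq' κ) n x ∂P := by
  have hfM := f.seq_mem.1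
  have hgM := isDyadicMartingale_riesz hp' hq' κ
  -- Orthogonality reduces the sum to the integral of f_N g_N. It remains to expand f_N in
  -- indicators of intervals of generation `N`.
  rw [hfM.sum_integral_mdiff_mul hgM hf.2]
  obtain ⟨c, hc⟩ := exists_eq_comp_dyadicIndex (hfM.measurable_dyadic N)
  set I := indicesIn N F
  have hc0 : ∀ k ∉ I, c k = 0 := by
    intro k hk
    obtain ⟨x, rfl⟩ := dyadicInterval_nonempty N k
    rw [← hc]
    exact hf.2 N x fun h => hk (dyadicIndex_mem_indicesIn.2 h)
  have hfN : ∀ x, f.seq N x = ∑ k ∈ I, c k * dyadicIndicator N k x := by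
    intro x
    rw [Finset.sum_eq_single (dyadicIndex N x)]
    · rw [hc, dyadicIndicator, indicator_of_mem (mem_dyadicInterval_dyadicIndex N x)]
      simp
    · intro k _ hk
      rw [dyadicIndicator, indicator_of_notMem (fun h => hk (dyadicIndex_eq_iff.2 h).symm), mul_zero]
    · intro h
      rw [hc0 _ h, zero_mul]
  have h1 : κ f = κ (∑ k ∈ I, c k • indicatorMartingale P hp' hq' N k) := by
    refine apply_eq_of_ae κ fun n => ?_
    have hint : ∀ n k, ∑ l ∈ I, c l * integralMass P (dyadicIndicator N l) n k =
        integralMass P (f.seq N) n k := by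
      intro n k
      simp only [integralMass, ← integral_const_mul]
      rw [← integral_finsetSum _ fun l _ =>
        ((integrable_dyadicIndicator N l).const_mul (c l)).integrableOn]
      simp only [hfN]
    -- That is, E_n f_N = f_n for every `n`: by the martingale property before `N`, by constancy
    -- after.
    have hmove : ∀ n k, ∫ x in dyadicInterval n k, f.seq N x ∂P =
        ∫ x in dyadicInterval n k, f.seq n x ∂P := by
      intro n k
      rcases le_total n N with h | h
      · exact hfM.setIntegral_eq h k
      · rw [hf.1 n h]
    filter_upwards [ae_measure_dyadicInterval_ne_zero P] with x hx
    have key : ∀ n, f.seq n x = ∑ k ∈ I, c k * density P n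
        (integralMass P (dyadicIndicator N k) n) x := by
      intro n
      rw [← density_integralMass (hfM.measurable_dyadic n) (hmove n) (hx n)]
      simp only [density, ← hint, Finset.sum_div, mul_div_assoc]
    -- Each indicator martingale has its generation-0 density subtracted; in the combination these
    -- terms add up to f_0 = 0.
    have key0 := key 0
    rw [hfM.1, Pi.zero_apply] at key0
    rw [HsMartingale.sum_smul_seq]
    simp only [indicatorMartingale_seq, massMartingale, Pi.sub_apply, mul_sub,
      Finset.sum_sub_distrib]
    rw [← key0, sub_zero, key n]
  have hi : Integrable (fun x => f.seq N x * riesz hp' hq' κ N x) P :=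
    integrable_of_vanish ((hfM.measurable_dyadic N).mul (hgM.measurable_dyadic N)) (F := F)
      fun x hx => by simp [hf.2 N x hx]
  have h2 : ∀ k, ∫ x in dyadicInterval N k, f.seq N x * riesz hp' hq' κ N x ∂P =
      c k * κ (indicatorMartingale P hp' hq' N k) := by
    intro k
    rw [← setIntegral_riesz, ← integral_const_mul]
    exact setIntegral_congr_fun (measurableSet_dyadicInterval' N k) fun x hx => by
      simp only [hc, dyadicIndex_eq_iff.2 hx]
  have h3 := hasSum_integral_dyadic N hi
  simp only [h2] at h3
  rw [h3.unique (hasSum_sum_of_ne_finset_zero (s := I) fun k hk => by simp [hc0 k hk]), h1, map_sum]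
  simp

end Finite

/-! ### Density of finite martingales -/

theorem tendsto_tsum_zero_of_dominated {ι : Type*} [Countable ι] {a : ℕ → ι → ℝ≥0∞}
    {b : ι → ℝ≥0∞} (hab : ∀ N i, a N i ≤ b i) (hb : ∑' i, b i ≠ ∞)
    (ha : ∀ i, Tendsto (fun N => a N i) atTop (nhds 0)) :
    Tendsto (fun N => ∑' i, a N i) atTop (nhds 0) := by
  let _ : MeasurableSpace ι := ⊤
  have := tendsto_lintegral_of_dominated_convergence (μ := Measure.count) (F := a) (f := 0) b
    (fun _ => measurable_from_top) (fun N => ae_of_all _ (hab N)) (by rwa [lintegral_count])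
    (ae_of_all _ ha)
  simpa [lintegral_count] using this

/-- The indicator of the times up to `N` and the cells with index in `[-N, N]`. -/
def truncation (N n : ℕ) : ℝ → ℝ :=
  if n ≤ N then (cells (Finset.Icc (-(N : ℤ)) N)).indicator 1 else 0

theorem measurable_truncation (N n m : ℕ) : Measurable[dyadicFiltration m] (truncation N n) := by
  unfold truncation
  split_ifs
  · exact measurable_dyadic_indicator_one (measurableSet_cells _ _)
  · exact @measurable_const _ _ _ (dyadicFiltration m) (0 : ℝ)

theorem isFiniteMartingale_truncation (f : ℕ → ℝ → ℝ) (N : ℕ) :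
    IsFiniteMartingale (transform (truncation N) f) N (Finset.Icc (-(N : ℤ)) N) :=
  isFiniteMartingale_transform (fun n hn => by simp [truncation, not_le.2 hn])
    fun n x hx => by rw [truncation]; split_ifs <;> simp [hx]

theorem enorm_one_sub_truncation_le (N n : ℕ) (x : ℝ) : ‖1 - truncation N n x‖ₑ ≤ 1 := by
  unfold truncation
  split_ifs
  · by_cases hx : x ∈ cells (Finset.Icc (-(N : ℤ)) N) <;> simp [hx]
  · simp

theorem truncation_eventually_one (n : ℕ) (x : ℝ) : ∀ᶠ N in atTop, truncation N n x = 1 := by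
  filter_upwards [eventually_ge_atTop n, eventually_ge_atTop (dyadicIndex 0 x).natAbs] with N h1 h2
  have : x ∈ cells (Finset.Icc (-(N : ℤ)) N) := by
    rw [mem_cells_iff, Finset.mem_Icc]; omega
  simp [truncation, h1, this]

theorem IsDyadicMartingale.sub_transform {f v : ℕ → ℝ → ℝ} (hf : IsDyadicMartingale P f) :
    f - DyadicHardy.transform v f = DyadicHardy.transform (1 - v) f := by
  ext n x
  rw [Pi.sub_apply, Pi.sub_apply, ← congrFun (hf.sum_mdiff n) x]
  simp [DyadicHardy.transform, sub_mul, Finset.sum_sub_distrib]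

/-- The remainder is again a transform with 0-1 weights, so its conditional variances are dominated
by those of `f`. Dominated convergence applies three times: over n, over each cell, and over the
cells; finite exponents are what permits this. -/
theorem IsDyadicMartingale.tendsto_truncation [IsFiniteMeasure P] {p q : ℝ≥0∞} (hp : p ≠ 0)
    (hp' : p ≠ ∞) (hq : q ≠ 0) (hq' : q ≠ ∞) {f : ℕ → ℝ → ℝ} (hf : IsDyadicMartingale P f)
    (hfin : amalgamNorm P p q (condSq P f) < ∞) :
    Tendsto (fun N => amalgamNorm P p q (condSq P (f - DyadicHardy.transform (truncation N) f)))
      atTop (nhds 0) := by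
  have hp0 : 0 < p.toReal := ENNReal.toReal_pos hp hp'
  have hq0 : 0 < q.toReal := ENNReal.toReal_pos hq hq'
  have hqp : 0 < q.toReal / p.toReal := by positivity
  rw [amalgamNorm_eq hp hp' hq hq'] at hfin
  simp only [amalgamNorm_eq hp hp' hq hq']
  have hsum : ∑' j : ℤ, (∫⁻ x in cell j, condSq P f x ^ p.toReal ∂P) ^
      (q.toReal / p.toReal) ≠ ∞ :=
    ((ENNReal.rpow_lt_top_iff_of_pos (by positivity)).1 hfin).ne
  have hcell : ∀ j, ∫⁻ x in cell j, condSq P f x ^ p.toReal ∂P ≠ ∞ := fun j =>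
    ((ENNReal.rpow_lt_top_iff_of_pos hqp).1 (ENNReal.ne_top_of_tsum_ne_top hsum j).lt_top).ne
  have hvar : ∀ᵐ x ∂P, ∀ N n, condVar P (f - DyadicHardy.transform (truncation N) f) n x =
      ‖1 - truncation N n x‖ₑ ^ 2 * condVar P f n x := by
    rw [ae_all_iff]
    intro N
    rw [hf.sub_transform]
    exact hf.condVar_transform fun n =>
      (@measurable_const _ _ _ (dyadicFiltration (n - 1)) (1 : ℝ)).sub (measurable_truncation N n _)
  have hle : ∀ᵐ x ∂P, ∀ N,
      condSq P (f - DyadicHardy.transform (truncation N) f) x ≤ condSq P f x := by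
    filter_upwards [hvar] with x hx N
    rw [condSq_eq, condSq_eq]
    gcongr with n
    rw [hx]
    exact mul_le_of_le_one_left zero_le (pow_le_one₀ zero_le (enorm_one_sub_truncation_le N n x))
  have hlim : ∀ᵐ x ∂P, condSq P f x ≠ ∞ → Tendsto
      (fun N => condSq P (f - DyadicHardy.transform (truncation N) f) x) atTop (nhds 0) := by
    filter_upwards [hvar] with x hx hxt
    simp only [condSq_eq, hx]
    have h1 : ∑' n, condVar P f n x ≠ ∞ := by
      rw [← condSq_sq']; exact ENNReal.pow_ne_top hxt
    have h2 : Tendsto (fun N => ∑' n, ‖1 - truncation N n x‖ₑ ^ 2 * condVar P f n x) atTop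
        (nhds 0) := by
      refine tendsto_tsum_zero_of_dominated (fun N n => mul_le_of_le_one_left zero_le
        (pow_le_one₀ zero_le (enorm_one_sub_truncation_le N n x))) h1 fun n => ?_
      refine tendsto_const_nhds.congr' ?_
      filter_upwards [truncation_eventually_one n x] with N hN
      simp [hN]
    have h3 := (ENNReal.continuous_rpow_const (y := 1 / 2)).tendsto 0 |>.comp h2
    rwa [ENNReal.zero_rpow_of_pos (by norm_num)] at h3
  have hint : ∀ j, Tendsto (fun N => ∫⁻ x in cell j,
      condSq P (f - DyadicHardy.transform (truncation N) f) x ^ p.toReal ∂P) atTop (nhds 0) := by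
    intro j
    have h1 : ∀ᵐ x ∂P.restrict (cell j), condSq P f x ≠ ∞ := by
      filter_upwards [ae_lt_top ((measurable_condSq P f).pow_const _) (hcell j)] with x hx
      exact ((ENNReal.rpow_lt_top_iff_of_pos hp0).1 hx).ne
    rw [← lintegral_zero (μ := P.restrict (cell j))]
    refine tendsto_lintegral_of_dominated_convergence (fun x => condSq P f x ^ p.toReal)
      (fun N => (measurable_condSq P _).pow_const _) (fun N => ?_) (hcell j) ?_
    · filter_upwards [ae_restrict_of_ae hle] with x hx
      gcongr
      exact hx N
    · filter_upwards [ae_restrict_of_ae hlim, h1] with x hx hxt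
      have h3 := (ENNReal.continuous_rpow_const (y := p.toReal)).tendsto 0 |>.comp (hx hxt)
      rwa [ENNReal.zero_rpow_of_pos hp0] at h3
  have hmain : Tendsto (fun N => ∑' j : ℤ, (∫⁻ x in cell j,
      condSq P (f - DyadicHardy.transform (truncation N) f) x ^ p.toReal ∂P) ^
        (q.toReal / p.toReal)) atTop (nhds 0) := by
    refine tendsto_tsum_zero_of_dominated (fun N j => ?_) hsum fun j => ?_
    · gcongr ?_ ^ _
      refine lintegral_mono_ae (ae_restrict_of_ae ?_)
      filter_upwards [hle] with x hx
      gcongr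
      exact hx N
    · have h3 := (ENNReal.continuous_rpow_const (y := q.toReal / p.toReal)).tendsto 0 |>.comp
        (hint j)
      rwa [ENNReal.zero_rpow_of_pos hqp] at h3
  have h3 := (ENNReal.continuous_rpow_const (y := 1 / q.toReal)).tendsto 0 |>.comp hmain
  rwa [ENNReal.zero_rpow_of_pos (by positivity)] at h3

/-- The constant of the lower bound. -/
def dualityConstant (p' : ℝ≥0∞) : ℝ :=
  max 1 (p'.toReal / 2) * (min 1 (p'.toReal - 1))⁻¹ ^ (1 / 2 : ℝ)

theorem dualityConstant_pos {p p' : ℝ≥0∞} (hp : p.toReal.HolderConjugate p'.toReal) :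
    0 < dualityConstant p' := by
  have hmin : 0 < min 1 (p'.toReal - 1) := lt_min one_pos (by linarith [hp.symm.lt])
  have hmax : 0 < max 1 (p'.toReal / 2) := lt_max_of_lt_left one_pos
  unfold dualityConstant
  positivity

/-! ### The duality isomorphism on the quotient spaces -/

section Duality

variable {p q p' q' : ℝ≥0∞} [Fact (1 ≤ p)] [Fact (1 ≤ q)] [Fact (1 ≤ p')] [Fact (1 ≤ q')]
  [IsFiniteMeasure P]

/-- Two functionals that agree on finite martingales are equal. -/
theorem functional_ext (hp' : p ≠ ∞) (hq' : q ≠ ∞) {κ κ' : HsMartingale P p q →L[ℝ] ℝ}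
    (h : ∀ (f : HsMartingale P p q) (N : ℕ) (F : Finset ℤ), IsFiniteMartingale f.seq N F →
      κ f = κ' f) : κ = κ' := by
  ext f
  have hp : p ≠ 0 := (zero_lt_one.trans_le (Fact.out : 1 ≤ p)).ne'
  have hq : q ≠ 0 := (zero_lt_one.trans_le (Fact.out : 1 ≤ q)).ne'
  let fN : ℕ → HsMartingale P p q := fun N => ⟨DyadicHardy.transform (truncation N) f.seq,
    (f.seq_mem.1.transform fun n => measurable_truncation N n _).mem_of_finite hp' hq'
      (isFiniteMartingale_truncation f.seq N)⟩
  have hlim : Tendsto fN atTop (nhds f) := by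
    rw [tendsto_iff_norm_sub_tendsto_zero]
    have h1 := f.seq_mem.1.tendsto_truncation hp hp' hq hq' f.seq_mem.2
    have h2 := (ENNReal.tendsto_toReal ENNReal.zero_ne_top).comp h1
    refine h2.congr fun N => ?_
    rw [norm_sub_rev]
    rfl
  refine tendsto_nhds_unique ((κ.continuous.tendsto f).comp hlim)
    (((κ'.continuous.tendsto f).comp hlim).congr fun N => ?_)
  exact (h (fN N) N _ (isFiniteMartingale_truncation f.seq N)).symm

theorem pairing_eq_sum (hp : p.toReal.HolderConjugate p'.toReal)
    (hq : q.toReal.HolderConjugate q'.toReal) (f : HsMartingale P p q) (g : HsMartingale P p' q')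
    {N : ℕ} {F : Finset ℤ} (hf : IsFiniteMartingale f.seq N F) :
    pairing P f.seq g.seq =
      ∑ n ∈ Finset.range (N + 1), ∫ x, mdiff f.seq n x * mdiff g.seq n x ∂P := by
  refine (hasSum_pairing hp hq f g).unique (hasSum_sum_of_ne_finset_zero fun n hn => ?_)
  rw [hf.mdiff_eq_zero (by simpa using hn)]
  simp

theorem norm_le_of_pairing (hp : p.toReal.HolderConjugate p'.toReal)
    (hq : q.toReal.HolderConjugate q'.toReal) (g : HsMartingale P p' q') {K : ℝ} (hK0 : 0 ≤ K)
    (hK : ∀ f : HsMartingale P p q, |pairing P f.seq g.seq| ≤ K * ‖f‖) :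
    ‖g‖ ≤ dualityConstant p' * K := by
  have hC := dualityConstant_pos hp
  refine ENNReal.toReal_le_of_le_ofReal (by positivity)
    (g.seq_mem.1.amalgamNorm_le hp hq hK0 fun f N F hf => ?_)
  rw [← pairing_eq_sum hp hq f g hf]
  exact hK f

/-- The lower bound with K = ‖κ‖ serves here as a membership criterion for `riesz`; the two
functionals then agree on the dense set of finite martingales. -/
theorem exists_pairing_eq (hp : p.toReal.HolderConjugate p'.toReal)
    (hq : q.toReal.HolderConjugate q'.toReal) (κ : HsMartingale P p q →L[ℝ] ℝ) :
    ∃ g : HsMartingale P p' q', pairingCLM hp hq g = κ := by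
  have hpt := (ENNReal.toReal_pos_iff.1 hp.pos).2.ne
  have hqt := (ENNReal.toReal_pos_iff.1 hq.pos).2.ne
  have hM := isDyadicMartingale_riesz hpt hqt κ
  let g : HsMartingale P p' q' := ⟨riesz hpt hqt κ, hM,
    (hM.amalgamNorm_le hp hq (norm_nonneg κ) fun f N F hf => by
      rw [← functional_eq_sum hpt hqt κ f hf]
      exact κ.le_opNorm f).trans_lt ENNReal.ofReal_lt_top⟩
  refine ⟨g, functional_ext hpt hqt fun f N F hf => ?_⟩
  rw [pairingCLM_apply, pairing_eq_sum hp hq f g hf, functional_eq_sum hpt hqt κ f hf]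
  rfl

theorem pairingCLM_eq_of_inseparable (hp : p.toReal.HolderConjugate p'.toReal)
    (hq : q.toReal.HolderConjugate q'.toReal) (g : HsMartingale P p' q') (x y : HsMartingale P p q)
    (h : Inseparable x y) : pairingCLM hp hq g x = pairingCLM hp hq g y :=
  (h.map (pairingCLM hp hq g).continuous).eq

/-- The functional `κ_g` on `H^s_{p,q}`, as a function of the martingale `g`. -/
def dualMap (hp : p.toReal.HolderConjugate p'.toReal) (hq : q.toReal.HolderConjugate q'.toReal) :
    HsMartingale P p' q' →L[ℝ] StrongDual ℝ (Hs P p q) :=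
  LinearMap.mkContinuous
    { toFun := fun g => SeparationQuotient.liftCLM (pairingCLM hp hq g)
        (pairingCLM_eq_of_inseparable hp hq g)
      map_add' := fun g₁ g₂ => by
        ext f
        obtain ⟨f, rfl⟩ := SeparationQuotient.surjective_mk f
        simp
      map_smul' := fun c g => by
        ext f
        obtain ⟨f, rfl⟩ := SeparationQuotient.surjective_mk f
        simp } 1 fun g => by
    rw [one_mul]
    refine ContinuousLinearMap.opNorm_le_bound _ (norm_nonneg g) fun f => ?_
    obtain ⟨f, rfl⟩ := SeparationQuotient.surjective_mk f
    exact norm_pairing_le hp hq f g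

/-- The duality map `g ↦ κ_g` of `H^s_{p',q'}` into the dual of `H^s_{p,q}`. -/
def dualityMap (hp : p.toReal.HolderConjugate p'.toReal)
    (hq : q.toReal.HolderConjugate q'.toReal) : Hs P p' q' →L[ℝ] StrongDual ℝ (Hs P p q) :=
  SeparationQuotient.liftCLM (dualMap hp hq) fun _ _ h => (h.map (dualMap hp hq).continuous).eq

theorem dualityMap_mk_mk (hp : p.toReal.HolderConjugate p'.toReal)
    (hq : q.toReal.HolderConjugate q'.toReal) (g : HsMartingale P p' q') (f : HsMartingale P p q) :
    dualityMap hp hq g.toHs f.toHs = pairing P f.seq g.seq := rfl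

theorem norm_dualityMap_le (hp : p.toReal.HolderConjugate p'.toReal)
    (hq : q.toReal.HolderConjugate q'.toReal) (g : Hs P p' q') :
    ‖(dualityMap hp hq g : StrongDual ℝ (Hs P p q))‖ ≤ ‖g‖ := by
  obtain ⟨g, rfl⟩ := SeparationQuotient.surjective_mk g
  refine ContinuousLinearMap.opNorm_le_bound _ (norm_nonneg _) fun f => ?_
  obtain ⟨f, rfl⟩ := SeparationQuotient.surjective_mk f
  exact norm_pairing_le hp hq f g

theorem norm_le_dualityMap (hp : p.toReal.HolderConjugate p'.toReal)
    (hq : q.toReal.HolderConjugate q'.toReal) (g : Hs P p' q') :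
    ‖g‖ ≤ dualityConstant p' * ‖(dualityMap hp hq g : StrongDual ℝ (Hs P p q))‖ := by
  obtain ⟨g, rfl⟩ := SeparationQuotient.surjective_mk g
  exact norm_le_of_pairing hp hq g (norm_nonneg _) fun f =>
    (dualityMap hp hq g.toHs : StrongDual ℝ (Hs P p q)).le_opNorm f.toHs

/-- Injectivity is the lower bound; surjectivity is the representation of κ pulled back to
martingales before identification. -/
theorem dualityMap_bijective (hp : p.toReal.HolderConjugate p'.toReal)
    (hq : q.toReal.HolderConjugate q'.toReal) :
    Function.Bijective (dualityMap hp hq : Hs P p' q' →L[ℝ] StrongDual ℝ (Hs P p q)) := by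
  refine ⟨(injective_iff_map_eq_zero _).2 fun g hg => ?_, fun κ => ?_⟩
  · have := norm_le_dualityMap hp hq g
    rw [hg, norm_zero, mul_zero] at this
    exact norm_le_zero_iff.1 this
  · obtain ⟨g, hg⟩ := exists_pairing_eq hp hq (κ.comp (SeparationQuotient.mkCLM ℝ _))
    refine ⟨g.toHs, ?_⟩
    ext f
    obtain ⟨f, rfl⟩ := SeparationQuotient.surjective_mk f
    exact DFunLike.congr_fun hg f

/-- The duality isomorphism of `H^s_{p',q'}` onto the dual of `H^s_{p,q}`. -/
def dualityEquiv (hp : p.toReal.HolderConjugate p'.toReal)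
    (hq : q.toReal.HolderConjugate q'.toReal) : Hs P p' q' ≃L[ℝ] StrongDual ℝ (Hs P p q) :=
  (LinearEquiv.ofBijective (dualityMap hp hq : Hs P p' q' →L[ℝ] StrongDual ℝ (Hs P p q)).toLinearMap
    (dualityMap_bijective hp hq)).toContinuousLinearEquivOfBounds 1 (dualityConstant p')
    (fun g => by rw [one_mul]; exact norm_dualityMap_le hp hq g)
    fun κ => by
      obtain ⟨g, rfl⟩ := (dualityMap_bijective hp hq).2 κ
      refine le_of_eq_of_le (congrArg norm ?_) (norm_le_dualityMap hp hq g)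
      exact LinearEquiv.symm_apply_apply _ g

end Duality

theorem holderConjugate_toReal {p p' : ℝ≥0∞} (h1 : 1 < p) (hp : p ≠ ∞) (h : p⁻¹ + p'⁻¹ = 1) :
    p.toReal.HolderConjugate p'.toReal := by
  have h0 : p' ≠ 0 := by rintro rfl; simp at h
  have h1' : 1 < p.toReal := by
    rw [← ENNReal.toReal_one]
    exact ENNReal.toReal_strict_mono hp h1
  refine (Real.holderConjugate_iff).2 ⟨h1', ?_⟩
  rw [← ENNReal.toReal_inv, ← ENNReal.toReal_inv, ← ENNReal.toReal_add
    (ENNReal.inv_ne_top.2 (zero_lt_one.trans h1).ne') (ENNReal.inv_ne_top.2 h0), h,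
    ENNReal.toReal_one]

end DyadicHardy

end

theorem theorem3p4 (p q p' q' : ℝ≥0∞)
    [Fact (1 ≤ p)] [Fact (1 ≤ q)] [Fact (1 ≤ p')] [Fact (1 ≤ q')]
    (hp : p⁻¹ + p'⁻¹ = 1) (hq : q⁻¹ + q'⁻¹ = 1)
    (hpq : (1 < q ∧ q ≤ p ∧ p ≤ 2) ∨ (2 ≤ p ∧ p ≤ q ∧ q < ∞)) :
    ∃ C : ℝ, 0 < C ∧ ∀ (P : Measure ℝ) [IsProbabilityMeasure P],
      (∀ (f : HsMartingale P p q) (g : HsMartingale P p' q'),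
        ∫⁻ x, ∑' n : ℕ, ‖mdiff f.seq n x * mdiff g.seq n x‖ₑ ∂P < ∞) ∧
      ∃ Φ : Hs P p' q' ≃L[ℝ] StrongDual ℝ (Hs P p q),
        (∀ (g : HsMartingale P p' q') (f : HsMartingale P p q),
          Φ g.toHs f.toHs = ∫ x, ∑' n : ℕ, mdiff f.seq n x * mdiff g.seq n x ∂P) ∧
        ∀ g : Hs P p' q', ‖Φ g‖ ≤ ‖g‖ ∧ ‖g‖ ≤ C * ‖Φ g‖ := by
  obtain ⟨hp1, hpt, hq1, hqt⟩ : 1 < p ∧ p ≠ ∞ ∧ 1 < q ∧ q ≠ ∞ := by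
    rcases hpq with ⟨h1, h2, h3⟩ | ⟨h1, h2, h3⟩
    · have hp2 := ne_top_of_le_ne_top ENNReal.ofNat_ne_top h3
      exact ⟨h1.trans_le h2, hp2, h1, ne_top_of_le_ne_top hp2 h2⟩
    · have hp2 := ENNReal.one_lt_two.trans_le h1
      exact ⟨hp2, (h2.trans_lt h3).ne, hp2.trans_le h2, h3.ne⟩
  have Hp := holderConjugate_toReal hp1 hpt hp
  have Hq := holderConjugate_toReal hq1 hqt hq
  exact ⟨dualityConstant p', dualityConstant_pos Hp, fun P _ => ⟨lintegral_tsum_lt_top Hp Hq,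
    dualityEquiv Hp Hq, fun g f => dualityMap_mk_mk Hp Hq g f, fun g =>
      ⟨norm_dualityMap_le Hp Hq g, norm_le_dualityMap Hp Hq g⟩⟩⟩
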